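/- Let $n\ge 3$, let $K$ be a field of characteristic $0$ (for instance $\mathbb C$), let $\mathfrak q,\mathfrak d\in K^\times$ with a fixed square root $\mathfrak q^{1/2}\in K$, and put $q_1=\mathfrak d\mathfrak q^{-1}$, $q_2=\mathfrak q^2$, $q_3=\mathfrak d^{-1}\mathfrak q^{-1}$. Assume that none of $q_1,q_2,q_3$ is a root of unity. Write $[r]=(\mathfrak q^r-\mathfrak q^{-r})/(\mathfrak q-\mathfrak q^{-1})$, let $\bar\delta$ be the Kronecker delta modulo $n$, and for $i,j\in\mathbb Z/n$ let $a_{ij}=2\bar\delta_{i,j}-\bar\delta_{i-1,j}-\bar\delta_{i+1,j}$, $m_{ij}=\bar\delta_{i-1,j}-\bar\delta_{i+1,j}$, $C^{[r]}_{ij}=\frac{[ra_{ij}]}{[r]}\mathfrak d^{-rm_{ij}}$ and $b^{[r]}=(C^{[r]})^{-1}$. Let $H_{i,r}$ ($i\in\mathbb Z/n$, $r\in\mathbb Z\setminus\{0\}$) act on the bosonic Fock space $K[H_{i,-r}: r\ge1]|\varnothing\rangle$, with $H_{i,r}|\varnothing\rangle=0$ for $r>0$ and $[H_{i,r},H_{j,s}]=\delta_{r+s,0}\frac{[r]^2}{r}C^{[r]}_{ij}$.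 Put $\Lambda_{i,r}=\frac1{[r]}\sum_j b^{[r]}_{ij}H_{j,r}$, so that $[\Lambda_{i,r},H_{j,s}]=\delta_{r+s,0}\bar\delta_{i,j}\frac{[r]}{r}$, and $$V_i^{(\pm)}(z)=\exp\Big(\mp\sum_{r\ge1}\frac{H_{i,\pm r}}{[r]}z^{\mp r}\Big),\qquad \widetilde V_i^{(\pm)}(z)=\exp\Big(\mp\sum_{r\ge1}\Lambda_{i,\pm r}z^{\mp r}\Big),$$ $$\eta_i(z)=V_i^{(-)}(\mathfrak q^{-1/2}z)V_i^{(+)}(\mathfrak q^{1/2}z),\qquad \xi_i(z)=V_i^{(-)}(\mathfrak q^{1/2}z)^{-1}V_i^{(+)}(\mathfrak q^{-1/2}z)^{-1}.$$ For partitions $\lambda,\mu$ (boxes $(i,j)$ in row $i$ and column $j$, counted from $1$) consider the oscillator parts of the components of the intertwiner and of the dual intertwiner, $$\Phi^\lambda(z)={:}\prod_{(i,j)\in\lambda}\eta_{i-j}(q_1^{j-1}q_3^{i-1}z)\,\Phi_\varnothing(z){:},\qquad \Phi_\varnothing(z)=\widetilde V_0^{(-)}(\mathfrak q^{1/2}z)\widetilde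 V_0^{(+)}(\mathfrak q^{3/2}z)^{-1},$$ $$\Phi^*_\mu(w)={:}\prod_{(i,j)\in\mu}\xi_{i-j}(q_1^{j-1}q_3^{i-1}w)\,\Phi^*_\varnothing(w){:},\qquad \Phi^*_\varnothing(w)=\widetilde V_0^{(-)}(\mathfrak q^{3/2}w)^{-1}\widetilde V_0^{(+)}(\mathfrak q^{1/2}w),$$ where ${:}\ {:}$ puts all creation modes to the left of all annihilation modes. For a partition $\lambda$ with transpose $\lambda'$ and any $s=(i,j)$ let $a_\lambda(s)=\lambda_i-j$, $\ell_\lambda(s)=\lambda'_j-i$ and $h_{\lambda,\mu}(s)=a_\mu(s)+\ell_\lambda(s)+1$, and define the bifundamental Nekrasov factor on $ALE_n\times S^1$ by $$N_{\lambda\mu}(u;q_1,q_3)=\prod_{\substack{s\in\lambda\\ h_{\mu,\lambda}(s)\equiv0\ (n)}}\big(1-u\,q_1^{a_\lambda(s)}q_3^{-\ell_\mu(s)-1}\big)\prod_{\substack{t\in\mu\\ h_{\lambda,\mu}(t)\equiv0\ (n)}}\big(1-u\,q_1^{-a_\mu(t)-1}q_3^{\ell_\lambda(t)}\big).$$ Then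 the following hold. (1) For all $\lambda,\mu$ there is a unique formal power series $\widetilde G_{\lambda\mu}(u)\in K[[u]]$ with $$\Phi^*_\mu(w)\Phi^\lambda(z)=\widetilde G_{\lambda\mu}(\mathfrak q^{-1}z/w)\,{:}\Phi^*_\mu(w)\Phi^\lambda(z){:}$$ on the Fock space (an identity of the coefficients of all monomials $w^mz^l$, expanded for $|w|>|z|$), and $\widetilde G_{\varnothing\varnothing}$ is invertible. (2) The renormalized OPE factor $G_{\lambda\mu}(u)=\widetilde G_{\lambda\mu}(u)/\widetilde G_{\varnothing\varnothing}(u)$ satisfies, for all $\lambda,\mu$, $$G_{\lambda\mu}(u)=N_{\lambda\mu}(u;q_1,q_3).$$ (3) Both factors satisfy the same recursion in $\mu$: if adding a box at the end of row $j$ of $\mu$ gives a partition $\mu+1_j$, and $\ell=j-\mu_j-1$ is the color of this box, then $$\frac{N_{\lambda\,\mu+1_j}(u)}{N_{\lambda\mu}(u)}=\frac{\prod_{1\le i\le\ell(\lambda)+1,\ i-\lambda_i\equiv\ell+1\ (n)}\big(1-u\,q_1^{\lambda_i-\mu_j-1}q_3^{i-j-1}\big)}{\prod_{1\le i\le\ell(\lambda),\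 i-\lambda_i\equiv\ell\ (n)}\big(1-u\,q_1^{\lambda_i-\mu_j-1}q_3^{i-j}\big)},$$ where $\ell(\lambda)$ is the number of rows of $\lambda$, and the same identity holds with $G$ in place of $N$. -/

import Mathlib

open scoped PowerSeries Polynomial

namespace ToroidalOPE

noncomputable section

/-! ### Parameters and the deformed Cartan matrix of type `A_{n-1}^{(1)}` -/

/-- The equivariant parameter `q₁ = 𝔡 𝔮⁻¹`. -/
def q1 {K : Type*} [Field K] (𝔮 𝔡 : K) : K := 𝔡 * 𝔮⁻¹

/-- The equivariant parameter `q₂ = 𝔮²`. -/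
def q2 {K : Type*} [Field K] (𝔮 : K) : K := 𝔮 ^ 2

/-- The equivariant parameter `q₃ = 𝔡⁻¹ 𝔮⁻¹`, so that `q₁ q₂ q₃ = 1`. -/
def q3 {K : Type*} [Field K] (𝔮 𝔡 : K) : K := 𝔡⁻¹ * 𝔮⁻¹

/-- The `𝔮`-integer `[r] = (𝔮^r - 𝔮^{-r}) / (𝔮 - 𝔮⁻¹)`. -/
def qInt {K : Type*} [Field K] (𝔮 : K) (r : ℤ) : K := (𝔮 ^ r - 𝔮 ^ (-r)) / (𝔮 - 𝔮⁻¹)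

/-- Kronecker delta modulo `n`. -/
def delta {n : ℕ} (i j : ZMod n) : ℤ := if i = j then 1 else 0

/-- The affine Cartan matrix `a_{ij}`. -/
def cartan {n : ℕ} (i j : ZMod n) : ℤ := 2 * delta i j - (delta (i - 1) j + delta (i + 1) j)

/-- The skew-symmetric matrix `m_{ij}`. -/
def skew {n : ℕ} (i j : ZMod n) : ℤ := delta (i - 1) j - delta (i + 1) j

/-- The deformed Cartan matrix `C^{[r]}`, with entries `([r a_{ij}] / [r]) 𝔡^{-r m_{ij}}`. -/
def defCartan {K : Type*} [Field K] (n : ℕ) (𝔮 𝔡 : K) (r : ℤ) : Matrix (ZMod n) (ZMod n) K :=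
  Matrix.of fun i j => qInt 𝔮 (r * cartan i j) / qInt 𝔮 r * 𝔡 ^ (-(r * skew i j))

/-- `b^{[r]}`, the inverse of the deformed Cartan matrix `C^{[r]}`. -/
def invCartan {K : Type*} [Field K] (n : ℕ) [NeZero n] (𝔮 𝔡 : K) (r : ℤ) :
    Matrix (ZMod n) (ZMod n) K :=
  (defCartan n 𝔮 𝔡 r)⁻¹

/-! ### The bosonic Fock space and the Heisenberg modes -/

/-- The bosonic Fock space: polynomials in the creation modes. The variable `X (i, m)` is the state
`H_{i,-(m+1)} |∅⟩` and `1` is the vacuum `|∅⟩`. -/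
abbrev Fock (n : ℕ) (K : Type*) [Field K] : Type _ := MvPolynomial (ZMod n × ℕ) K

/-- The Heisenberg modes `H_{i,r}` (`r ≠ 0`) acting on the Fock space at level `c = 1`:
`H_{i,-r}` is multiplication, `H_{i,r}` annihilates the vacuum, and
`[H_{i,r}, H_{j,s}] = δ_{r+s,0} ([r][r]/r) C^{[r]}_{ij}`. There is no mode `r = 0`
(the value `0` there is never used). -/
def heis {K : Type*} [Field K] (n : ℕ) [NeZero n] (𝔮 𝔡 : K) (i : ZMod n) :
    ℤ → Module.End K (Fock n K)
  | .negSucc m => LinearMap.mulLeft K (MvPolynomial.X (i, m))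
  | .ofNat 0 => 0
  | .ofNat (m + 1) =>
      ∑ j : ZMod n,
        (qInt 𝔮 (m + 1) ^ 2 / ((m : K) + 1) * defCartan n 𝔮 𝔡 (m + 1) i j) •
          (MvPolynomial.pderiv (R := K) (j, m)).toLinearMap

/-- The dual modes `Λ_{i,r} = [r]⁻¹ ∑_j b^{[r]}_{ij} H_{j,r}`, which satisfy
`[Λ_{i,r}, H_{j,s}] = δ_{r+s,0} δ_{ij} [r]/r` and `[Λ_{i,r}, Λ_{j,s}] = -δ_{r+s,0} b^{[r]}_{ij}/r`. -/
def dualHeis {K : Type*} [Field K] (n : ℕ) [NeZero n] (𝔮 𝔡 : K) (i : ZMod n) (r : ℤ) :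
    Module.End K (Fock n K) :=
  (qInt 𝔮 r)⁻¹ • ∑ j : ZMod n, invCartan n 𝔮 𝔡 r i j • heis n 𝔮 𝔡 j r

/-! ### Normal ordered vertex operators

A vertex operator is a normal ordered exponential `:exp(∑_{r ≠ 0} J_r z^{-r}):`
`= exp(∑_{r > 0} J_{-r} z^r) exp(∑_{r > 0} J_r z^{-r})`, where each `J_r` is a linear combination of
the modes `H_{i,r}`. It is recorded by its exponent `J`. The normal ordered product of vertex
operators adds the exponents, the inverse of `V_i^{(±)}(z)` flips the sign of its exponent, and the
substitution `z ↦ x z` replaces `J_r` by `x^{-r} J_r`. -/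

/-- Exponents `J(z) = ∑_{r ≠ 0} J_r z^{-r}` of normal ordered vertex operators. -/
abbrev Exponent (n : ℕ) (K : Type*) [Field K] : Type _ := ℤ → Module.End K (Fock n K)

/-- The exponent `J(x z)`. -/
def scale {K : Type*} [Field K] {n : ℕ} (x : K) (J : Exponent n K) : Exponent n K :=
  fun r => x ^ (-r) • J r

/-- The exponent of `V_i^{(+)}(z) = exp(-∑_{r ≥ 1} H_{i,r} z^{-r} / [r])`. -/
def vPlus {K : Type*} [Field K] (n : ℕ) [NeZero n] (𝔮 𝔡 : K) (i : ZMod n) : Exponent n K :=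
  fun r => if 0 < r then -((qInt 𝔮 r)⁻¹ • heis n 𝔮 𝔡 i r) else 0

/-- The exponent of `V_i^{(-)}(z) = exp(∑_{r ≥ 1} H_{i,-r} z^r / [r])`. -/
def vMinus {K : Type*} [Field K] (n : ℕ) [NeZero n] (𝔮 𝔡 : K) (i : ZMod n) : Exponent n K :=
  fun r => if r < 0 then (qInt 𝔮 (-r))⁻¹ • heis n 𝔮 𝔡 i r else 0

/-- The exponent of the dual vertex operator `exp(-∑_{r ≥ 1} Λ_{i,r} z^{-r})`. -/
def dualVPlus {K : Type*} [Field K] (n : ℕ) [NeZero n] (𝔮 𝔡 : K) (i : ZMod n) : Exponent n K :=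
  fun r => if 0 < r then -dualHeis n 𝔮 𝔡 i r else 0

/-- The exponent of the dual vertex operator `exp(∑_{r ≥ 1} Λ_{i,-r} z^r)`. -/
def dualVMinus {K : Type*} [Field K] (n : ℕ) [NeZero n] (𝔮 𝔡 : K) (i : ZMod n) : Exponent n K :=
  fun r => if r < 0 then dualHeis n 𝔮 𝔡 i r else 0

/-- `η_i(z) = V_i^{(-)}(𝔮^{-1/2} z) V_i^{(+)}(𝔮^{1/2} z)`; here and below `𝔰` is `𝔮^{1/2}`. -/
def eta {K : Type*} [Field K] (n : ℕ) [NeZero n] (𝔰 𝔮 𝔡 : K) (i : ZMod n) : Exponent n K :=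
  scale 𝔰⁻¹ (vMinus n 𝔮 𝔡 i) + scale 𝔰 (vPlus n 𝔮 𝔡 i)

/-- `ξ_i(z) = V_i^{(-)}(𝔮^{1/2} z)⁻¹ V_i^{(+)}(𝔮^{-1/2} z)⁻¹`. -/
def xi {K : Type*} [Field K] (n : ℕ) [NeZero n] (𝔰 𝔮 𝔡 : K) (i : ZMod n) : Exponent n K :=
  -scale 𝔰 (vMinus n 𝔮 𝔡 i) - scale 𝔰⁻¹ (vPlus n 𝔮 𝔡 i)

/-- The vacuum component `Φ_∅(z) = Ṽ_0^{(-)}(𝔮^{1/2} z) Ṽ_0^{(+)}(𝔮^{3/2} z)⁻¹` of the intertwiner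
(the vacuum has color `0`). -/
def vacuumIntertwiner {K : Type*} [Field K] (n : ℕ) [NeZero n] (𝔰 𝔮 𝔡 : K) : Exponent n K :=
  scale 𝔰 (dualVMinus n 𝔮 𝔡 0) - scale (𝔰 ^ 3) (dualVPlus n 𝔮 𝔡 0)

/-- The vacuum component `Φ*_∅(w) = Ṽ_0^{(-)}(𝔮^{3/2} w)⁻¹ Ṽ_0^{(+)}(𝔮^{1/2} w)` of the dual
intertwiner. -/
def vacuumDualIntertwiner {K : Type*} [Field K] (n : ℕ) [NeZero n] (𝔰 𝔮 𝔡 : K) : Exponent n K :=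
  -scale (𝔰 ^ 3) (dualVMinus n 𝔮 𝔡 0) + scale 𝔰 (dualVPlus n 𝔮 𝔡 0)

/-- The color `i - j` mod `n` of a box. Boxes are indexed from `(0, 0)`. -/
def color (n : ℕ) (s : ℕ × ℕ) : ZMod n := (s.1 : ZMod n) - (s.2 : ZMod n)

/-- The weight `q₁^{j-1} q₃^{i-1}` of the box in row `i`, column `j` (counted from `1`). -/
def boxWeight {K : Type*} [Field K] (𝔮 𝔡 : K) (s : ℕ × ℕ) : K :=
  q1 𝔮 𝔡 ^ s.2 * q3 𝔮 𝔡 ^ s.1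

/-- The oscillator part `:∏_{(i,j) ∈ λ} η_{i-j}(q₁^{j-1} q₃^{i-1} z) Φ_∅(z):` of the `λ`-component
`Φ^λ(z)` of the intertwiner. -/
def intertwiner {K : Type*} [Field K] (n : ℕ) [NeZero n] (𝔰 𝔮 𝔡 : K) (lam : YoungDiagram) :
    Exponent n K :=
  ∑ s ∈ lam.cells, scale (boxWeight 𝔮 𝔡 s) (eta n 𝔰 𝔮 𝔡 (color n s)) +
    vacuumIntertwiner n 𝔰 𝔮 𝔡

/-- The oscillator part `:∏_{(i,j) ∈ μ} ξ_{i-j}(q₁^{j-1} q₃^{i-1} w) Φ*_∅(w):` of the `μ`-component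
`Φ*_μ(w)` of the dual intertwiner. -/
def dualIntertwiner {K : Type*} [Field K] (n : ℕ) [NeZero n] (𝔰 𝔮 𝔡 : K) (mu : YoungDiagram) :
    Exponent n K :=
  ∑ s ∈ mu.cells, scale (boxWeight 𝔮 𝔡 s) (xi n 𝔰 𝔮 𝔡 (color n s)) +
    vacuumDualIntertwiner n 𝔰 𝔮 𝔡

/-! ### Modes of vertex operators and operator product factors -/

/-- The exponential `∑_k A^k / k!` of a power series `A` with zero constant term and operator
coefficients. -/
def expSeries {K : Type*} [Field K] {n : ℕ} (A : (Module.End K (Fock n K))⟦X⟧) :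
    (Module.End K (Fock n K))⟦X⟧ :=
  PowerSeries.mk fun m =>
    ∑ k ∈ Finset.range (m + 1), ((k.factorial : K)⁻¹) • PowerSeries.coeff m (A ^ k)

/-- The creation part `exp(∑_{r ≥ 1} J_{-r} z^r)`, a power series in `z`. -/
def creation {K : Type*} [Field K] {n : ℕ} (J : Exponent n K) : (Module.End K (Fock n K))⟦X⟧ :=
  expSeries (PowerSeries.mk fun r => if r = 0 then 0 else J (-(r : ℤ)))

/-- The annihilation part `exp(∑_{r ≥ 1} J_r z^{-r})`, a power series in `z⁻¹`. -/
def annihilation {K : Type*} [Field K] {n : ℕ} (J : Exponent n K) :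
    (Module.End K (Fock n K))⟦X⟧ :=
  expSeries (PowerSeries.mk fun r => if r = 0 then 0 else J (r : ℤ))

/-- Coefficients of a power series, extended by `0` to negative degrees. -/
def coeffZ {R : Type*} [Semiring R] (A : R⟦X⟧) (m : ℤ) : R :=
  if 0 ≤ m then PowerSeries.coeff m.toNat A else 0

/-- The coefficient of `w^m` in `A(w) v`, where `A(w)` is the vertex operator with exponent `J`.
The sum is finite, since annihilation parts act locally nilpotently. -/
def mode {K : Type*} [Field K] {n : ℕ} (J : Exponent n K) (m : ℤ) (v : Fock n K) : Fock n K :=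
  ∑ᶠ a : ℕ, coeffZ (creation J) (m + a) (PowerSeries.coeff a (annihilation J) v)

/-- The coefficient of `w^m z^l` in `:A(w) B(z): v`, where `A` and `B` have exponents `J`, `J'`:
all creation parts stand to the left of all annihilation parts. -/
def normalOrderedMode {K : Type*} [Field K] {n : ℕ} (J J' : Exponent n K) (m l : ℤ)
    (v : Fock n K) : Fock n K :=
  ∑ᶠ p : ℕ × ℕ,
    coeffZ (creation J) (m + p.1) (coeffZ (creation J') (l + p.2)
      (PowerSeries.coeff p.1 (annihilation J) (PowerSeries.coeff p.2 (annihilation J') v)))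

/-- `A(w) B(z) = g(z/w) :A(w) B(z):` on the Fock space, as an identity between the coefficients of
`w^m z^l` for all `m`, `l`, where `g` is expanded in powers of `z/w` (the region `|w| > |z|`). -/
def IsOPE {K : Type*} [Field K] {n : ℕ} (J J' : Exponent n K) (g : K⟦X⟧) : Prop :=
  ∀ (m l : ℤ) (v : Fock n K),
    mode J m (mode J' l v) =
      ∑ᶠ k : ℕ, PowerSeries.coeff k g • normalOrderedMode J J' (m + k) (l - k) v

/-- `G(u)` is an OPE factor of `Φ*_μ(w)` and `Φ^λ(z)`:
`Φ*_μ(w) Φ^λ(z) = G(𝔮⁻¹ z/w) :Φ*_μ(w) Φ^λ(z):`. -/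
def IsOPEFactor {K : Type*} [Field K] (n : ℕ) [NeZero n] (𝔰 𝔮 𝔡 : K) (lam mu : YoungDiagram)
    (G : K⟦X⟧) : Prop :=
  IsOPE (dualIntertwiner n 𝔰 𝔮 𝔡 mu) (intertwiner n 𝔰 𝔮 𝔡 lam) (PowerSeries.rescale 𝔮⁻¹ G)

/-- The OPE factor `G̃_{λμ}(u)` of `Φ*_μ` and `Φ^λ`. -/
def opeFactor {K : Type*} [Field K] (n : ℕ) [NeZero n] (𝔰 𝔮 𝔡 : K) (lam mu : YoungDiagram) :
    K⟦X⟧ :=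
  Classical.epsilon (IsOPEFactor n 𝔰 𝔮 𝔡 lam mu)

/-- The renormalized OPE factor `G_{λμ}(u) = G̃_{λμ}(u) / G̃_{∅∅}(u)`. -/
def renormalizedOPEFactor {K : Type*} [Field K] (n : ℕ) [NeZero n] (𝔰 𝔮 𝔡 : K)
    (lam mu : YoungDiagram) : K⟦X⟧ :=
  opeFactor n 𝔰 𝔮 𝔡 lam mu * (opeFactor n 𝔰 𝔮 𝔡 ⊥ ⊥)⁻¹

/-! ### The bifundamental Nekrasov factor on `ALE_n × S¹` -/

/-- The arm length `a_λ(i,j) = λ_i - j`, for any box `(i,j)`; it can be negative. -/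
def arm (lam : YoungDiagram) (s : ℕ × ℕ) : ℤ := (lam.rowLen s.1 : ℤ) - (s.2 + 1)

/-- The leg length `ℓ_λ(i,j) = λ'_j - i`, for any box `(i,j)`; it can be negative. -/
def leg (lam : YoungDiagram) (s : ℕ × ℕ) : ℤ := (lam.colLen s.2 : ℤ) - (s.1 + 1)

/-- The relative hook length `h_{λ,μ}(s) = a_μ(s) + ℓ_λ(s) + 1`. -/
def relHook (lam mu : YoungDiagram) (s : ℕ × ℕ) : ℤ := arm mu s + leg lam s + 1

/-- The Nekrasov factor `N_{λμ}(u; p₁, p₃)`, a polynomial in `u`. -/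
def nekrasov {K : Type*} [Field K] (n : ℕ) (p1 p3 : K) (lam mu : YoungDiagram) : K[X] :=
  (∏ s ∈ lam.cells with (n : ℤ) ∣ relHook mu lam s,
      (1 - Polynomial.C (p1 ^ arm lam s * p3 ^ (-leg mu s - 1)) * Polynomial.X)) *
    ∏ t ∈ mu.cells with (n : ℤ) ∣ relHook lam mu t,
      (1 - Polynomial.C (p1 ^ (-arm mu t - 1) * p3 ^ leg lam t) * Polynomial.X)

/-- `∏_{1 ≤ i ≤ ℓ(λ)+1, i - λ_i ≡ ℓ + 1} (1 - u p₁^{λ_i - μ_j - 1} p₃^{i - j - 1})` with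
`ℓ = j - μ_j - 1`; in the code `i` and `j` are counted from `0`. -/
def recursionNum {K : Type*} [Field K] (n : ℕ) (p1 p3 : K) (lam mu : YoungDiagram) (j : ℕ) :
    K[X] :=
  ∏ i ∈ (Finset.range (lam.colLen 0 + 1)).filter (fun i : ℕ =>
      ((i : ℤ) + 1 - lam.rowLen i) ≡ ((j : ℤ) + 1 - mu.rowLen j - 1) + 1 [ZMOD n]),
    (1 - Polynomial.C (p1 ^ ((lam.rowLen i : ℤ) - mu.rowLen j - 1) *
      p3 ^ ((i : ℤ) - j - 1)) * Polynomial.X)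

/-- `∏_{1 ≤ i ≤ ℓ(λ), i - λ_i ≡ ℓ} (1 - u p₁^{λ_i - μ_j - 1} p₃^{i - j})` with
`ℓ = j - μ_j - 1`; in the code `i` and `j` are counted from `0`. -/
def recursionDen {K : Type*} [Field K] (n : ℕ) (p1 p3 : K) (lam mu : YoungDiagram) (j : ℕ) :
    K[X] :=
  ∏ i ∈ (Finset.range (lam.colLen 0)).filter (fun i : ℕ =>
      ((i : ℤ) + 1 - lam.rowLen i) ≡ ((j : ℤ) + 1 - mu.rowLen j - 1) [ZMOD n]),
    (1 - Polynomial.C (p1 ^ ((lam.rowLen i : ℤ) - mu.rowLen j - 1) *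
      p3 ^ ((i : ℤ) - j)) * Polynomial.X)

/-- `μ' = μ + 1_j`: the diagram `μ'` arises from `μ` by adding a box at the end of row `j`
(counted from `0`). -/
def IsAddBox (mu mu' : YoungDiagram) (j : ℕ) : Prop :=
  mu'.cells = insert (j, mu.rowLen j) mu.cells

end

end ToroidalOPE

/-!
The annihilation part of `Φ*_μ(w)` has to be moved past the creation part of `Φ^λ(z)`. Both are
exponentials of modes of a Heisenberg algebra, and the commutators of these modes are scalars `c_r` in
degree `r`, so that the reordering produces the factor `g(z/w)` with `g(x) = exp (∑ c_r x^r)`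
(`coeff_expSeries_mul_coeffZ`, `isOPE_of_commutator`). The local finiteness of the mode expansions
comes from the weight filtration of the Fock space: an annihilation mode of degree `r` lowers the
weight by `r`. The factor is unique because it is a vacuum matrix element of the product
(`IsOPE.mode_mode_one`).

All power series with constant term `1` are handled through their logarithmic derivative
`X A' / A = -∑ p_r X^r`, recorded by `HasPowerSums`; in characteristic zero it determines `A`, and for
a product of factors `1 - y X` the `p_r` are the power sums of the `y`. Two products of operator
product factors and Nekrasov factors are thus equal as soon as their power sums agree in each degree.

In degree `r`, the factorization `𝔮^r C^{[r]} = (1 - q₃^{-r} S) (1 - q₁^{-r} S⁻¹)`, with `S` the cyclic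
shift of the colors, shows that `r c_r`, up to its vacuum part `b^{[r]}_{00}`, is minus the `r`-th power
sum of the part of the character
`∑_{t ∈ μ} q₂ χ_t⁻¹ + ∑_{s ∈ λ} χ_s - (1 - q₁⁻¹) (1 - q₃⁻¹) ∑_{s,t} χ_s χ_t⁻¹`
whose monomials `q₁^a q₃^b` satisfy `b ≡ a` modulo `n` (`neg_opeScalar`), after the substitution
`z/w = 𝔮 u`. It remains to see that this character equals the arm-leg character
`∑_{s ∈ λ} q₁^{a_λ(s)} q₃^{-ℓ_μ(s)-1} + ∑_{t ∈ μ} q₁^{-a_μ(t)-1} q₃^{ℓ_λ(t)}` of the Nekrasov factor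
(`nekrasovSum_eq_contractionSum`). Adding a box to `μ` changes both by the same sum over rows of `λ`:
the first by telescoping along rows, the second by summing along the boundary of `λ` in two ways
(`sum_boundary`). This sum over rows is also the recursion satisfied by both factors. All of this holds
for an arbitrary function `f a b` in place of the monomial `q₁^a q₃^b`, so the restriction to
`b ≡ a` modulo `n` needs no separate treatment.
-/

namespace ToroidalOPE

/-! ### The Euler operator on power series -/

/-- The Euler operator `X d/dX` on power series over a semiring that need not be commutative. -/
noncomputable def euler {R : Type*} [Semiring R] (A : R⟦X⟧) : R⟦X⟧ :=
  PowerSeries.mk fun m => m • PowerSeries.coeff m A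

section Euler

variable {R : Type*} [Semiring R]

@[simp] lemma coeff_euler (A : R⟦X⟧) (m : ℕ) :
    PowerSeries.coeff m (euler A) = m • PowerSeries.coeff m A := by
  simp [euler]

lemma euler_add (A B : R⟦X⟧) : euler (A + B) = euler A + euler B := by
  ext m; simp [smul_add]

@[simp] lemma euler_zero : euler (0 : R⟦X⟧) = 0 := by
  ext m; simp

lemma euler_sum {ι : Type*} (s : Finset ι) (f : ι → R⟦X⟧) :
    euler (∑ i ∈ s, f i) = ∑ i ∈ s, euler (f i) := by
  classical
  induction s using Finset.induction_on with
  | empty => simp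
  | insert a s ha ih => rw [Finset.sum_insert ha, Finset.sum_insert ha, euler_add, ih]

@[simp] lemma euler_C (a : R) : euler (PowerSeries.C a : R⟦X⟧) = 0 := by
  ext m
  rcases eq_or_ne m 0 with rfl | hm
  · simp
  · simp [PowerSeries.coeff_C, hm]

@[simp] lemma euler_one : euler (1 : R⟦X⟧) = 0 := by
  simpa using euler_C (1 : R)

lemma euler_mul (A B : R⟦X⟧) : euler (A * B) = euler A * B + A * euler B := by
  ext m
  simp only [coeff_euler, map_add, PowerSeries.coeff_mul, Finset.smul_sum, ← Finset.sum_add_distrib]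
  refine Finset.sum_congr rfl fun p hp => ?_
  rw [← Finset.HasAntidiagonal.mem_antidiagonal.1 hp, add_smul, smul_mul_assoc, mul_smul_comm]

lemma euler_pow_of_commute {A : R⟦X⟧} (h : Commute A (euler A)) (k : ℕ) :
    euler (A ^ (k + 1)) = (k + 1) • (euler A * A ^ k) := by
  induction k with
  | zero => simp
  | succ k ih =>
    rw [pow_succ' A (k + 1), euler_mul, ih, mul_smul_comm, ← mul_assoc, h.eq, mul_assoc,
      ← pow_succ', succ_nsmul _ (k + 1), add_comm]

lemma euler_smul {K : Type*} [Field K] [Module K R] (c : K) (A : R⟦X⟧) :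
    euler (c • A) = c • euler A := by
  ext m
  simp [smul_comm]

/-- In characteristic zero, a differential equation `X Y' = P Y` with `P(0) = 0` has at most one
solution with a given constant term. -/
lemma eq_of_euler_eq_mul {K R : Type*} [Field K] [CharZero K] [Ring R] [Module K R]
    {P Y Z : R⟦X⟧} (hP : PowerSeries.coeff 0 P = 0) (hY : euler Y = P * Y) (hZ : euler Z = P * Z)
    (h0 : PowerSeries.coeff 0 Y = PowerSeries.coeff 0 Z) : Y = Z := by
  ext m
  induction m using Nat.strong_induction_on with
  | _ m ih =>
    rcases eq_or_ne m 0 with rfl | hm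
    · exact h0
    · have h : m • PowerSeries.coeff m Y = m • PowerSeries.coeff m Z := by
        rw [← coeff_euler, ← coeff_euler, hY, hZ, PowerSeries.coeff_mul, PowerSeries.coeff_mul]
        refine Finset.sum_congr rfl fun p hp => ?_
        rw [Finset.HasAntidiagonal.mem_antidiagonal] at hp
        rcases eq_or_ne p.1 0 with h1 | h1
        · simp [h1, hP]
        · rw [ih p.2 (by omega)]
      rw [← Nat.cast_smul_eq_nsmul K, ← Nat.cast_smul_eq_nsmul K] at h
      have hm' : (m : K) ≠ 0 := Nat.cast_ne_zero.2 hm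
      simpa [smul_smul, inv_mul_cancel₀ hm'] using congrArg (fun x => (m : K)⁻¹ • x) h

end Euler

/-! ### Exponentials of operator valued power series -/

section Exp

variable {K : Type*} [Field K] {n : ℕ}

/-- The exponential `∑_{k < N} A^k / k!`, truncated in the powers of `A`. It agrees with the full
exponential in degrees below `N`. -/
noncomputable def truncExp (A : (Module.End K (Fock n K))⟦X⟧) (N : ℕ) :
    (Module.End K (Fock n K))⟦X⟧ :=
  ∑ k ∈ Finset.range N, ((k.factorial : K)⁻¹) • A ^ k

lemma coeff_pow_eq_zero {R : Type*} [Semiring R] {A : R⟦X⟧} (hA : PowerSeries.coeff 0 A = 0)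
    {m k : ℕ} (h : m < k) : PowerSeries.coeff m (A ^ k) = 0 := by
  induction k generalizing m with
  | zero => omega
  | succ k ih =>
    rw [pow_succ', PowerSeries.coeff_mul]
    refine Finset.sum_eq_zero fun p hp => ?_
    rw [Finset.HasAntidiagonal.mem_antidiagonal] at hp
    rcases eq_or_ne p.1 0 with h1 | h1
    · simp [h1, hA]
    · rw [ih (by omega), mul_zero]

lemma coeff_expSeries {A : (Module.End K (Fock n K))⟦X⟧} (hA : PowerSeries.coeff 0 A = 0)
    {m N : ℕ} (h : m < N) :
    PowerSeries.coeff m (expSeries A) = PowerSeries.coeff m (truncExp A N) := by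
  rw [expSeries, PowerSeries.coeff_mk, truncExp, map_sum]
  refine (Finset.sum_subset (Finset.range_subset_range.2 h) fun k _ hk => ?_).trans
    (Finset.sum_congr rfl fun k _ => rfl)
  rw [coeff_pow_eq_zero hA (by simpa using hk), smul_zero]

lemma coeff_zero_expSeries (A : (Module.End K (Fock n K))⟦X⟧) :
    PowerSeries.coeff 0 (expSeries A) = 1 := by
  simp [expSeries]

lemma coeff_mul_congr {R : Type*} [Semiring R] (A : R⟦X⟧) {B C : R⟦X⟧} {m : ℕ}
    (h : ∀ k ≤ m, PowerSeries.coeff k B = PowerSeries.coeff k C) :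
    PowerSeries.coeff m (A * B) = PowerSeries.coeff m (A * C) := by
  rw [PowerSeries.coeff_mul, PowerSeries.coeff_mul]
  refine Finset.sum_congr rfl fun p hp => ?_
  rw [Finset.HasAntidiagonal.mem_antidiagonal] at hp
  rw [h p.2 (by omega)]

variable [CharZero K]

lemma inv_factorial_succ_smul {M : Type*} [AddCommGroup M] [Module K M] (k : ℕ) (x : M) :
    (((k + 1).factorial : K)⁻¹) • ((k + 1) • x) = ((k.factorial : K)⁻¹) • x := by
  rw [← Nat.cast_smul_eq_nsmul K, smul_smul, Nat.factorial_succ, Nat.cast_mul, mul_inv,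
    mul_right_comm, inv_mul_cancel₀ (Nat.cast_ne_zero.2 k.succ_ne_zero), one_mul]

lemma euler_expSeries {A : (Module.End K (Fock n K))⟦X⟧} (hA : PowerSeries.coeff 0 A = 0)
    (hc : ∀ i j, Commute (PowerSeries.coeff i A) (PowerSeries.coeff j A)) :
    euler (expSeries A) = euler A * expSeries A := by
  have hcomm : Commute A (euler A) := by
    ext1 m
    rw [PowerSeries.coeff_mul, PowerSeries.coeff_mul, ← Finset.Nat.sum_antidiagonal_swap]
    refine Finset.sum_congr rfl fun p _ => ?_
    simpa only [coeff_euler, Prod.fst_swap, Prod.snd_swap] using ((hc p.2 p.1).smul_right p.1).eq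
  have htr : ∀ N, euler (truncExp A (N + 1)) = euler A * truncExp A N := fun N => by
    rw [truncExp, Finset.sum_range_succ', euler_add, euler_sum, truncExp, Finset.mul_sum]
    simp only [Nat.factorial_zero, Nat.cast_one, inv_one, pow_zero, one_smul, euler_one, add_zero]
    refine Finset.sum_congr rfl fun k _ => ?_
    rw [euler_smul, euler_pow_of_commute hcomm, inv_factorial_succ_smul, mul_smul_comm]
  ext1 m
  rw [coeff_euler, coeff_expSeries hA (show m < m + 1 + 1 by omega), ← coeff_euler, htr]
  exact coeff_mul_congr _ fun k hk => (coeff_expSeries hA (by omega)).symm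

/-- If the commutator of an operator `a` with the exponent `B(z)` is the scalar `c z^r`, then so is
its commutator with `exp B(z)`, up to the factor `exp B(z)`. -/
lemma mul_coeff_expSeries {B : (Module.End K (Fock n K))⟦X⟧} (hB : PowerSeries.coeff 0 B = 0)
    {a : Module.End K (Fock n K)} {c : K} {r : ℕ}
    (h : ∀ s, a * PowerSeries.coeff s B = PowerSeries.coeff s B * a + if s = r then c • 1 else 0)
    (b : ℤ) :
    a * coeffZ (expSeries B) b = coeffZ (expSeries B) b * a + c • coeffZ (expSeries B) (b - r) := by
  have h1 : PowerSeries.C a * B = B * PowerSeries.C a + c • PowerSeries.X ^ r := by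
    ext1 s
    simp only [PowerSeries.coeff_C_mul, map_add, PowerSeries.coeff_mul_C, h]
    congr 1
    rw [PowerSeries.coeff_smul, PowerSeries.coeff_X_pow]
    split_ifs <;> simp
  have hX : ∀ Y : (Module.End K (Fock n K))⟦X⟧, Y * PowerSeries.X ^ r = PowerSeries.X ^ r * Y :=
    fun Y => (PowerSeries.commute_X_pow Y r).eq
  have hpow : ∀ k, PowerSeries.C a * B ^ (k + 1) = B ^ (k + 1) * PowerSeries.C a +
      (k + 1) • (c • (PowerSeries.X ^ r * B ^ k)) := fun k => by
    induction k with
    | zero => simp [h1]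
    | succ k ih =>
      rw [pow_succ' B (k + 1), ← mul_assoc, h1, add_mul, mul_assoc, ih, mul_add, ← mul_assoc,
        succ_nsmul _ (k + 1), add_assoc, mul_smul_comm, mul_smul_comm, ← mul_assoc, hX,
        mul_assoc (PowerSeries.X ^ r), smul_mul_assoc, ← pow_succ', ← pow_succ']
  have htr : ∀ N, PowerSeries.C a * truncExp B (N + 1) = truncExp B (N + 1) * PowerSeries.C a +
      c • (PowerSeries.X ^ r * truncExp B N) := fun N => by
    rw [truncExp, Finset.sum_range_succ', truncExp, mul_add, add_mul, Finset.mul_sum,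
      Finset.sum_mul, Finset.mul_sum, Finset.smul_sum, add_right_comm, ← Finset.sum_add_distrib]
    congr 1
    · refine Finset.sum_congr rfl fun k _ => ?_
      rw [mul_smul_comm, hpow, smul_add, inv_factorial_succ_smul, smul_mul_assoc, mul_smul_comm,
        smul_comm c]
    · simp
  rcases lt_or_ge b 0 with hb | hb
  · simp [coeffZ, hb.not_ge, (show ¬ (r : ℤ) ≤ b by omega)]
  · lift b to ℕ using hb
    have := congrArg (PowerSeries.coeff b) (htr (b + 1))
    rw [PowerSeries.coeff_C_mul, map_add, PowerSeries.coeff_mul_C, PowerSeries.coeff_smul,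
      ← coeff_expSeries hB (by omega), PowerSeries.coeff_X_pow_mul'] at this
    simp only [coeffZ, Int.natCast_nonneg, if_true, Int.toNat_natCast]
    rw [this]
    congr 2
    rcases le_or_gt r b with hr | hr
    · have e : ((b : ℤ) - r) = ((b - r : ℕ) : ℤ) := by omega
      rw [if_pos hr, e, if_pos (by omega), Int.toNat_natCast, ← coeff_expSeries hB (by omega)]
    · rw [if_neg (by omega), if_neg (by omega)]

/-- The exponential of a scalar power series, as a solution of its differential equation. -/
lemma exists_euler_eq_mul {P : K⟦X⟧} (hP : PowerSeries.coeff 0 P = 0) :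
    ∃ g : K⟦X⟧, PowerSeries.coeff 0 g = 1 ∧ euler g = P * g := by
  have hX : ∀ A : K⟦X⟧, euler A = PowerSeries.X * PowerSeries.derivative K A := fun A => by
    ext m
    rcases m with _ | m
    · simp
    · simp [PowerSeries.coeff_succ_X_mul, PowerSeries.coeff_derivative, mul_comm]
  let C : K⟦X⟧ := PowerSeries.mk fun r => (r : K)⁻¹ * PowerSeries.coeff r P
  have hC : PowerSeries.constantCoeff C = 0 := by simp [C]
  have hs : PowerSeries.HasSubst C := PowerSeries.HasSubst.of_constantCoeff_zero' hC
  have hCP : euler C = P := by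
    ext m
    rcases eq_or_ne m 0 with rfl | hm
    · simp [hP]
    · simp [C, mul_inv_cancel_left₀ (Nat.cast_ne_zero.2 hm : (m : K) ≠ 0)]
  refine ⟨(PowerSeries.exp K).subst C, ?_, ?_⟩
  · rw [PowerSeries.coeff_zero_eq_constantCoeff_apply]
    have h1 : (PowerSeries.exp K) = 1 + (PowerSeries.exp K - 1) := by ring
    have h2 : PowerSeries.constantCoeff ((PowerSeries.exp K - 1).subst C) = 0 :=
      PowerSeries.constantCoeff_subst_eq_zero hC _ (by simp)
    rw [h1, ← PowerSeries.coe_substAlgHom hs, map_add, map_one,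
      PowerSeries.coe_substAlgHom, map_add, h2, map_one, add_zero]
  · rw [← hCP, hX, hX, PowerSeries.derivative_subst hs, PowerSeries.derivative_exp]
    ring

/-- The commutation relation `exp A(x) exp B(y) = g(x y) exp B(y) exp A(x)` when the commutator
`[A(x), B(y)]` is the scalar `∑ c_r (x y)^r` and `g = exp (∑ c_r u^r)`, in components. -/
theorem coeff_expSeries_mul_coeffZ {A B : (Module.End K (Fock n K))⟦X⟧}
    (hA : PowerSeries.coeff 0 A = 0) (hB : PowerSeries.coeff 0 B = 0)
    (hc : ∀ i j, Commute (PowerSeries.coeff i A) (PowerSeries.coeff j A)) {c : ℕ → K}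
    (h : ∀ r s, PowerSeries.coeff r A * PowerSeries.coeff s B =
      PowerSeries.coeff s B * PowerSeries.coeff r A + if s = r then c r • 1 else 0)
    {g : K⟦X⟧} (hg0 : PowerSeries.coeff 0 g = 1)
    (hg : euler g = (PowerSeries.mk fun r => (r : K) * c r) * g) (b : ℤ) (a : ℕ) :
    PowerSeries.coeff a (expSeries A) * coeffZ (expSeries B) b =
      ∑ p ∈ Finset.HasAntidiagonal.antidiagonal a, PowerSeries.coeff p.1 g •
        (coeffZ (expSeries B) (b - p.1) * PowerSeries.coeff p.2 (expSeries A)) := by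
  set F := coeffZ (expSeries B) with hF
  set Γ : (Module.End K (Fock n K))⟦X⟧ :=
    PowerSeries.mk fun k => PowerSeries.coeff k g • F (b - k) with hΓ
  -- both sides solve `X Y' = X A' Y`
  have hΓ' : euler A * Γ = Γ * euler A + euler Γ := by
    ext1 m
    have hgm := congrArg (PowerSeries.coeff m) hg
    rw [coeff_euler, PowerSeries.coeff_mul] at hgm
    rw [map_add, coeff_euler, PowerSeries.coeff_mul, PowerSeries.coeff_mul,
      ← Finset.Nat.sum_antidiagonal_swap (n := m) (f := fun p => PowerSeries.coeff p.1 Γ * _)]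
    simp only [hΓ, coeff_euler, PowerSeries.coeff_mk, Prod.fst_swap, Prod.snd_swap]
    rw [← smul_assoc, hgm, Finset.sum_smul, ← Finset.sum_add_distrib]
    refine Finset.sum_congr rfl fun p hp => ?_
    rw [Finset.HasAntidiagonal.mem_antidiagonal] at hp
    have hpm : b - (p.2 : ℤ) - (p.1 : ℤ) = b - (m : ℤ) := by omega
    rw [mul_smul_comm, smul_mul_assoc, mul_coeff_expSeries hB (h p.1), smul_add, smul_add, hpm,
      smul_mul_assoc, mul_smul_comm, PowerSeries.coeff_mk, ← Nat.cast_smul_eq_nsmul K,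
      ← Nat.cast_smul_eq_nsmul K, smul_smul, smul_smul, smul_smul]
    congr 2
    ring
  have key : expSeries A * PowerSeries.C (F b) = Γ * expSeries A := by
    refine eq_of_euler_eq_mul (K := K) (P := euler A) (by simp) ?_ ?_ ?_
    · rw [euler_mul, euler_C, mul_zero, add_zero, euler_expSeries hA hc, mul_assoc]
    · rw [euler_mul, euler_expSeries hA hc, ← mul_assoc, ← mul_assoc, hΓ', add_mul, add_comm]
    · simp [PowerSeries.coeff_mul, coeff_zero_expSeries, hΓ, hg0]
  have := congrArg (PowerSeries.coeff a) key
  rw [PowerSeries.coeff_mul_C, PowerSeries.coeff_mul] at this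
  rw [this]
  refine Finset.sum_congr rfl fun p _ => ?_
  rw [hΓ, PowerSeries.coeff_mk, smul_mul_assoc]

end Exp

/-! ### The weight filtration of the Fock space -/

section Weight

variable {K : Type*} [Field K] {n : ℕ}

/-- The states of weight at most `d`, where `H_{i,-(m+1)}` has weight `m + 1`. -/
noncomputable def weightLE (n : ℕ) (K : Type*) [Field K] (d : ℤ) : Submodule K (Fock n K) :=
  MvPolynomial.restrictSupport K {s | (Finsupp.weight (fun x : ZMod n × ℕ => x.2 + 1) s : ℤ) ≤ d}

/-- The operator `T` lowers the weight by at least `r`. -/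
def LowersWeight (r : ℕ) (T : Module.End K (Fock n K)) : Prop :=
  ∀ d, ∀ v ∈ weightLE n K d, T v ∈ weightLE n K (d - r)

lemma eq_zero_of_mem_weightLE {d : ℤ} (hd : d < 0) {v : Fock n K} (hv : v ∈ weightLE n K d) :
    v = 0 := by
  rw [weightLE, MvPolynomial.mem_restrictSupport_iff] at hv
  rw [← MvPolynomial.support_eq_empty, Finset.eq_empty_iff_forall_notMem]
  intro s hs
  have := hv hs
  simp only [Set.mem_ofPred_eq] at this
  omega

lemma one_mem_weightLE : (1 : Fock n K) ∈ weightLE n K 0 := by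
  rw [weightLE, MvPolynomial.mem_restrictSupport_iff]
  intro s hs
  have : s = 0 := by
    by_contra h
    simp at hs
    exact h hs
  simp [this]

lemma exists_mem_weightLE (v : Fock n K) : ∃ d : ℕ, v ∈ weightLE n K d := by
  refine ⟨v.support.sup (Finsupp.weight fun x : ZMod n × ℕ => x.2 + 1), ?_⟩
  rw [weightLE, MvPolynomial.mem_restrictSupport_iff]
  intro s hs
  exact Int.ofNat_le.2 (Finset.le_sup (f := Finsupp.weight fun x : ZMod n × ℕ => x.2 + 1) hs)

lemma LowersWeight.zero (r : ℕ) : LowersWeight r (0 : Module.End K (Fock n K)) :=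
  fun _ _ _ => by simp

lemma LowersWeight.add {r : ℕ} {S T : Module.End K (Fock n K)} (hS : LowersWeight r S)
    (hT : LowersWeight r T) : LowersWeight r (S + T) :=
  fun d v hv => Submodule.add_mem _ (hS d v hv) (hT d v hv)

lemma LowersWeight.smul {r : ℕ} {T : Module.End K (Fock n K)} (hT : LowersWeight r T) (c : K) :
    LowersWeight r (c • T) :=
  fun d v hv => Submodule.smul_mem _ _ (hT d v hv)

lemma LowersWeight.sum {r : ℕ} {ι : Type*} {s : Finset ι} {T : ι → Module.End K (Fock n K)}
    (hT : ∀ i ∈ s, LowersWeight r (T i)) : LowersWeight r (∑ i ∈ s, T i) := fun d v hv => by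
  rw [LinearMap.sum_apply]
  exact Submodule.sum_mem _ fun i hi => hT i hi d v hv

lemma LowersWeight.mul {r s : ℕ} {S T : Module.End K (Fock n K)} (hS : LowersWeight r S)
    (hT : LowersWeight s T) : LowersWeight (r + s) (S * T) := fun d v hv => by
  have := hS _ _ (hT d v hv)
  rwa [sub_sub, add_comm (s : ℤ), ← Nat.cast_add] at this

lemma lowersWeight_pderiv (j : ZMod n) (m : ℕ) :
    LowersWeight (m + 1) (MvPolynomial.pderiv (R := K) (j, m)).toLinearMap := fun d v hv => by
  rw [weightLE, MvPolynomial.restrictSupport_eq_span] at hv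
  refine Submodule.span_induction ?_ (by simp) ?_ ?_ hv
  · rintro _ ⟨s, hs, rfl⟩
    simp only [Set.mem_ofPred_eq] at hs
    simp only [Derivation.coeFn_coe, MvPolynomial.pderiv_monomial, one_mul]
    rcases eq_or_ne (s (j, m)) 0 with h0 | h0
    · simp [h0]
    · rw [weightLE, MvPolynomial.mem_restrictSupport_iff]
      refine (Finset.coe_subset.2 MvPolynomial.support_monomial_subset).trans ?_
      simp only [Finset.coe_singleton, Set.singleton_subset_iff, Set.mem_ofPred_eq]
      have hle : Finsupp.single (j, m) 1 ≤ s := by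
        rw [Finsupp.single_le_iff]; omega
      have hw := congrArg (Finsupp.weight fun x : ZMod n × ℕ => x.2 + 1) (tsub_add_cancel_of_le hle)
      rw [map_add, Finsupp.weight_single] at hw
      simp only [smul_eq_mul, one_mul] at hw
      push_cast
      omega
  · intro x y _ _ hx hy
    rw [map_add]
    exact Submodule.add_mem _ hx hy
  · intro a x _ hx
    rw [map_smul]
    exact Submodule.smul_mem _ _ hx

end Weight

/-! ### Operator products of exponentials -/

section OPE

variable {K : Type*} [Field K] {n : ℕ}

/-- The properties of exponents of vertex operators on which operator products rest: the
annihilation modes commute, and the mode of degree `r` lowers the weight by `r`. -/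
structure IsVertexExponent (J : Exponent n K) : Prop where
  commute : ∀ r s : ℕ, 0 < r → 0 < s → Commute (J r) (J s)
  lowers : ∀ r : ℕ, 0 < r → LowersWeight r (J r)

lemma coeff_zero_creation (J : Exponent n K) : PowerSeries.coeff 0 (creation J) = 1 :=
  coeff_zero_expSeries _

lemma coeff_zero_annihilation (J : Exponent n K) : PowerSeries.coeff 0 (annihilation J) = 1 :=
  coeff_zero_expSeries _

variable [CharZero K]

/-- By the differential equation of the exponential, the annihilation part inherits the weights of
its exponent. -/
lemma IsVertexExponent.lowers_annihilation {J : Exponent n K} (hJ : IsVertexExponent J) (a : ℕ) :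
    LowersWeight a (PowerSeries.coeff a (annihilation J)) := by
  have hE := euler_expSeries (A := PowerSeries.mk fun r => if r = 0 then 0 else J (r : ℤ)) (by simp)
    (fun i j => by
      rcases Nat.eq_zero_or_pos i with rfl | hi
      · simp
      rcases Nat.eq_zero_or_pos j with rfl | hj
      · simp
      simpa [hi.ne', hj.ne'] using hJ.commute i j hi hj)
  change euler (annihilation J) = _ * annihilation J at hE
  induction a using Nat.strong_induction_on with
  | _ a ih =>
    rcases Nat.eq_zero_or_pos a with rfl | ha
    · rw [coeff_zero_annihilation]
      intro d v hv
      simpa using hv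
    · have h := congrArg (PowerSeries.coeff a) hE
      rw [coeff_euler, PowerSeries.coeff_mul, ← Nat.cast_smul_eq_nsmul K] at h
      have ha' : (a : K) ≠ 0 := Nat.cast_ne_zero.2 ha.ne'
      rw [← inv_smul_smul₀ ha' (PowerSeries.coeff a (annihilation J)), h]
      refine (LowersWeight.sum fun p hp => ?_).smul _
      rw [Finset.HasAntidiagonal.mem_antidiagonal] at hp
      rw [coeff_euler, PowerSeries.coeff_mk, ← Nat.cast_smul_eq_nsmul K, smul_mul_assoc]
      refine LowersWeight.smul ?_ _
      split_ifs with h0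
      · rw [zero_mul]; exact LowersWeight.zero _
      · rw [← hp]
        exact (hJ.lowers _ (Nat.pos_of_ne_zero h0)).mul (ih _ (by omega))

lemma IsVertexExponent.annihilation_one {J : Exponent n K} (hJ : IsVertexExponent J) {a : ℕ}
    (ha : 0 < a) : PowerSeries.coeff a (annihilation J) (1 : Fock n K) = 0 :=
  eq_zero_of_mem_weightLE (by omega) (hJ.lowers_annihilation a 0 1 one_mem_weightLE)

lemma coeffZ_of_neg {R : Type*} [Semiring R] (A : R⟦X⟧) {m : ℤ} (h : m < 0) : coeffZ A m = 0 :=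
  if_neg h.not_ge

/-- Vertex operators whose exponents have scalar commutators `[J_r, J'_{-s}] = δ_{r,s} c_r` have the
operator product factor `exp (∑ c_r u^r)`. -/
theorem isOPE_of_commutator {J J' : Exponent n K} (hJ : IsVertexExponent J)
    (hJ' : IsVertexExponent J') {c : ℕ → K}
    (h : ∀ r s : ℕ, 0 < r → 0 < s →
      J r * J' (-(s : ℤ)) = J' (-(s : ℤ)) * J r + if s = r then c r • 1 else 0)
    {g : K⟦X⟧} (hg0 : PowerSeries.coeff 0 g = 1)
    (hg : euler g = (PowerSeries.mk fun r => (r : K) * c r) * g) : IsOPE J J' g := by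
  intro m l v
  set E := fun a => PowerSeries.coeff a (annihilation J) with hE
  set E' := fun a => PowerSeries.coeff a (annihilation J') with hE'
  set F := coeffZ (creation J) with hF
  set F' := coeffZ (creation J') with hF'
  obtain ⟨D, hD⟩ := exists_mem_weightLE v
  have hE'0 : ∀ b, D < b → E' b v = 0 := fun b hb =>
    eq_zero_of_mem_weightLE (by omega) (hJ'.lowers_annihilation b D v hD)
  have hE0 : ∀ a b, D < a → E a (E' b v) = 0 := fun a b ha =>
    eq_zero_of_mem_weightLE (d := D - b - a) (by omega)
      (hJ.lowers_annihilation a _ _ (hJ'.lowers_annihilation b D v hD))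
  -- the commutation relation `E_a F'_b = ∑ g_k F'_{b-k} E_{a-k}`
  have hcomm : ∀ (a : ℕ) (b : ℤ) (x : Fock n K), E a (F' b x) =
      ∑ p ∈ Finset.HasAntidiagonal.antidiagonal a,
        PowerSeries.coeff p.1 g • F' (b - p.1) (E p.2 x) := by
    intro a b x
    have := coeff_expSeries_mul_coeffZ
      (A := PowerSeries.mk fun r => if r = 0 then 0 else J (r : ℤ))
      (B := PowerSeries.mk fun r => if r = 0 then 0 else J' (-(r : ℤ)))
      (c := fun r => if r = 0 then 0 else c r) (g := g) (by simp) (by simp)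
      (fun i j => by
        rcases Nat.eq_zero_or_pos i with rfl | hi
        · simp
        rcases Nat.eq_zero_or_pos j with rfl | hj
        · simp
        simpa [hi.ne', hj.ne'] using hJ.commute i j hi hj)
      (fun r s => by
        rcases Nat.eq_zero_or_pos r with rfl | hr
        · simp
        rcases Nat.eq_zero_or_pos s with rfl | hs
        · simp [hr.ne]
        simpa [hr.ne', hs.ne'] using h r s hr hs)
      hg0 (by
        rw [hg]
        congr 1
        ext r
        by_cases hr : r = 0 <;> simp [hr]) b a
    have hx := congrArg (fun T : Module.End K (Fock n K) => T x) this
    rw [LinearMap.sum_apply] at hx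
    exact hx
  -- the contribution of `g_k` and the annihilation mode `E_p`
  let T : ℕ → ℕ → Fock n K := fun k p => ∑ p' ∈ Finset.range (D + 1),
    PowerSeries.coeff k g • F (m + k + p) (F' (l - k + p') (E p (E' p' v)))
  have hT1 : ∀ k p, D < p → T k p = 0 := fun k p hp =>
    Finset.sum_eq_zero fun p' _ => by rw [hE0 _ _ hp]; simp
  have hT2 : ∀ k p, l.toNat + D < k → T k p = 0 := fun k p hk =>
    Finset.sum_eq_zero fun p' hp' => by
      rw [Finset.mem_range] at hp'
      rw [hF', coeffZ_of_neg _ (by omega)]; simp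
  have hmode : mode J' l v = ∑ p' ∈ Finset.range (D + 1), F' (l + p') (E' p' v) := by
    refine finsum_eq_sum_of_support_subset _ fun b hb => ?_
    rw [Finset.coe_range, Set.mem_Iio]
    by_contra hb'
    refine hb ?_
    change F' (l + b) (E' b v) = 0
    rw [hE'0 b (by omega), map_zero]
  have hinner : ∀ a : ℕ, F (m + a) (E a (mode J' l v)) =
      ∑ p ∈ Finset.HasAntidiagonal.antidiagonal a, T p.1 p.2 := by
    intro a
    rw [hmode, map_sum, map_sum, Finset.sum_comm]
    refine Finset.sum_congr rfl fun p' _ => ?_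
    rw [hcomm, map_sum]
    refine Finset.sum_congr rfl fun p hp => ?_
    rw [Finset.HasAntidiagonal.mem_antidiagonal] at hp
    rw [map_smul, ← hp, Nat.cast_add, ← add_assoc, add_sub_right_comm]
  have hL : mode J m (mode J' l v) = ∑ a ∈ Finset.range (l.toNat + D + 1 + (D + 1)),
      ∑ p ∈ Finset.HasAntidiagonal.antidiagonal a, T p.1 p.2 := by
    rw [← Finset.sum_congr rfl fun a _ => hinner a]
    refine finsum_eq_sum_of_support_subset _ fun a ha => ?_
    rw [Finset.coe_range, Set.mem_Iio]
    by_contra ha'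
    refine ha ((hinner a).trans (Finset.sum_eq_zero fun p hp => ?_))
    rw [Finset.HasAntidiagonal.mem_antidiagonal] at hp
    rcases lt_or_ge D p.2 with h1 | h1
    · exact hT1 _ _ h1
    · exact hT2 _ _ (by omega)
  have hNO : ∀ k : ℕ, PowerSeries.coeff k g • normalOrderedMode J J' (m + k) (l - k) v =
      ∑ p ∈ Finset.range (D + 1), T k p := by
    intro k
    rw [normalOrderedMode, finsum_eq_sum_of_support_subset (s := Finset.range (D + 1) ×ˢ
      Finset.range (D + 1)), Finset.sum_product, Finset.smul_sum]
    · exact Finset.sum_congr rfl fun p _ => Finset.smul_sum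
    · intro p hp
      rw [Finset.coe_product, Finset.coe_range, Set.mem_prod, Set.mem_Iio, Set.mem_Iio]
      by_contra hp'
      refine hp ?_
      change F _ (F' _ (E p.1 (E' p.2 v))) = 0
      rcases lt_or_ge D p.1 with h1 | h1
      · rw [hE0 _ _ h1]; simp
      · rw [hE'0 p.2 (by omega)]; simp
  rw [hL]
  -- the sum over `a = k + p` is regrouped into a sum over `k` and `p`
  calc _ = ∑ x ∈ Finset.range (l.toNat + D + 1) ×ˢ Finset.range (D + 1), T x.1 x.2 := by
        rw [← Finset.sum_fiberwise_of_maps_to (g := fun x : ℕ × ℕ => x.1 + x.2)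
          (t := Finset.range (l.toNat + D + 1 + (D + 1)))]
        · refine Finset.sum_congr rfl fun a _ => (Finset.sum_subset ?_ ?_).symm
          · intro p hp
            rw [Finset.HasAntidiagonal.mem_antidiagonal]
            exact (Finset.mem_filter.1 hp).2
          · intro p hp hp'
            rw [Finset.HasAntidiagonal.mem_antidiagonal] at hp
            rcases lt_or_ge D p.2 with h1 | h1
            · exact hT1 _ _ h1
            · refine hT2 _ _ ?_
              simp only [Finset.mem_filter, Finset.mem_product, Finset.mem_range] at hp'
              omega
        · intro x hx
          simp only [Finset.mem_product, Finset.mem_range] at hx ⊢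
          omega
    _ = ∑ k ∈ Finset.range (l.toNat + D + 1), ∑ p ∈ Finset.range (D + 1), T k p :=
        Finset.sum_product _ _ _
    _ = _ := by
        rw [← Finset.sum_congr rfl fun k _ => hNO k]
        refine (finsum_eq_sum_of_support_subset _ fun k hk => ?_).symm
        rw [Finset.coe_range, Set.mem_Iio]
        by_contra hk'
        exact hk ((hNO k).trans (Finset.sum_eq_zero fun p _ => hT2 _ _ (by omega)))

/-- An operator product factor is the vacuum matrix element of the product: on the vacuum, only one
normal ordered mode contributes. -/
lemma IsOPE.mode_mode_one {J J' : Exponent n K} (hJ : IsVertexExponent J)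
    (hJ' : IsVertexExponent J') {g : K⟦X⟧} (h : IsOPE J J' g) (k : ℕ) :
    mode J (-k) (mode J' k (1 : Fock n K)) = MvPolynomial.C (PowerSeries.coeff k g) := by
  have hNO : ∀ m l : ℤ, normalOrderedMode J J' m l (1 : Fock n K) =
      coeffZ (creation J) m (coeffZ (creation J') l 1) := by
    intro m l
    rw [normalOrderedMode, finsum_eq_single _ (0, 0)]
    · simp [coeff_zero_annihilation]
    · rintro ⟨a, b⟩ hab
      rcases Nat.eq_zero_or_pos b with rfl | hb
      · have ha : 0 < a := by
          rcases Nat.eq_zero_or_pos a with rfl | ha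
          · exact absurd rfl hab
          · exact ha
        simp [coeff_zero_annihilation, hJ.annihilation_one ha]
      · simp [hJ'.annihilation_one hb]
  rw [h, finsum_eq_single _ k]
  · rw [hNO]
    simp [coeffZ, coeff_zero_creation, MvPolynomial.smul_eq_C_mul]
  · intro k' hk'
    rw [hNO]
    rcases lt_or_gt_of_ne hk' with hlt | hlt
    · rw [coeffZ_of_neg (creation J) (by omega)]; simp
    · rw [coeffZ_of_neg (creation J') (by omega)]; simp

lemma IsOPE.unique {J J' : Exponent n K} (hJ : IsVertexExponent J)
    (hJ' : IsVertexExponent J') {g g' : K⟦X⟧} (h : IsOPE J J' g) (h' : IsOPE J J' g') : g = g' := by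
  ext k
  exact MvPolynomial.C_injective _ _
    ((h.mode_mode_one hJ hJ' k).symm.trans (h'.mode_mode_one hJ hJ' k))

end OPE

/-! ### The deformed Cartan matrix -/

section Cartan

variable {K : Type*} [Field K] {n : ℕ} {𝔮 𝔡 : K}

lemma qInt_neg (r : ℤ) : qInt 𝔮 (-r) = -qInt 𝔮 r := by
  rw [qInt, qInt, neg_neg, ← neg_div, neg_sub]

lemma qInt_ne_zero (h𝔮 : 𝔮 ≠ 0) (h2 : ∀ r : ℕ, 0 < r → q2 𝔮 ^ r ≠ 1) {r : ℕ} (hr : 0 < r) :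
    qInt 𝔮 r ≠ 0 := by
  have key : ∀ k : ℕ, 0 < k → 𝔮 ^ (k : ℤ) - 𝔮 ^ (-(k : ℤ)) ≠ 0 := by
    intro k hk h
    refine h2 k hk ?_
    rw [zpow_neg, zpow_natCast, sub_eq_zero] at h
    rw [q2, ← pow_mul, mul_comm, pow_mul, sq]
    nth_rewrite 1 [h]
    exact inv_mul_cancel₀ (pow_ne_zero _ h𝔮)
  refine div_ne_zero (key r hr) ?_
  simpa using key 1 one_pos

lemma ne_sub_one_add_one (hn : 2 < n) (i : ZMod n) : i - 1 ≠ i ∧ i + 1 ≠ i ∧ i - 1 ≠ i + 1 := by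
  have : Fact (1 < n) := ⟨by omega⟩
  have h2 : (2 : ZMod n) ≠ 0 := by
    have := (ZMod.natCast_eq_zero_iff 2 n).not.2 (Nat.not_dvd_of_pos_of_lt two_pos hn)
    exact_mod_cast this
  refine ⟨by simp, by simp, fun h => h2 ?_⟩
  linear_combination -h

lemma defCartan_apply (hn : 2 < n) {r : ℤ} (hr : qInt 𝔮 r ≠ 0) (i j : ZMod n) :
    defCartan n 𝔮 𝔡 r i j = (if i = j then 𝔮 ^ r + 𝔮 ^ (-r) else 0) -
      (if i - 1 = j then 𝔡 ^ (-r) else 0) - (if i + 1 = j then 𝔡 ^ r else 0) := by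
  obtain ⟨h1, h2, h3⟩ := ne_sub_one_add_one hn i
  have hne : 𝔮 ^ r - 𝔮 ^ (-r) ≠ 0 := fun h => hr (by rw [qInt, h, zero_div])
  have hne' : 𝔮 - 𝔮⁻¹ ≠ 0 := fun h => hr (by rw [qInt, h, div_zero])
  simp only [defCartan, Matrix.of_apply, cartan, skew, delta]
  rcases eq_or_ne i j with rfl | hij
  · have e1 : 𝔮 ^ (r * 2) = (𝔮 ^ r) ^ 2 := by rw [zpow_mul, zpow_ofNat]
    have e2 : 𝔮 ^ (-(r * 2)) = (𝔮 ^ (-r)) ^ 2 := by rw [← neg_mul, zpow_mul, zpow_ofNat]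
    simp only [if_true, h1, h2, if_false, sub_zero, mul_one, add_zero, mul_zero, neg_zero,
      zpow_zero, qInt, e1, e2]
    rw [div_div_div_cancel_right₀ hne', div_eq_iff hne]
    ring
  rcases eq_or_ne (i - 1) j with hj | hj
  · have h4 : i + 1 ≠ j := fun h => h3 (hj.trans h.symm)
    simp only [hij, hj, h4, if_true, if_false, zero_sub, mul_zero, add_zero, mul_neg, mul_one,
      sub_zero, qInt_neg, neg_div, div_self hr, neg_mul, one_mul]
  rcases eq_or_ne (i + 1) j with hj' | hj'
  · simp only [hij, hj, hj', if_true, if_false, zero_sub, mul_zero, zero_add, mul_neg, mul_one,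
      neg_neg, qInt_neg, neg_div, div_self hr, neg_mul, one_mul, sub_zero]
  · simp [hij, hj, hj', qInt]

lemma defCartan_neg (hn : 2 < n) {r : ℤ} (hr : qInt 𝔮 r ≠ 0) :
    defCartan n 𝔮 𝔡 (-r) = (defCartan n 𝔮 𝔡 r).transpose := by
  ext i j
  rw [Matrix.transpose_apply, defCartan_apply hn hr,
    defCartan_apply hn (by rw [qInt_neg]; exact neg_ne_zero.2 hr)]
  have e1 : j - 1 = i ↔ i + 1 = j := ⟨fun h => by rw [← h]; ring, fun h => by rw [← h]; ring⟩
  have e2 : j + 1 = i ↔ i - 1 = j := ⟨fun h => by rw [← h]; ring, fun h => by rw [← h]; ring⟩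
  simp only [neg_neg, e1, e2, eq_comm (a := j), add_comm (𝔮 ^ r)]
  ring

/-- A function on `ℤ/n` that is multiplied by `x` under a unit shift vanishes unless `x ^ n = 1`. -/
lemma eq_zero_of_shift {f : ZMod n → K} {x : K} (hx : x ^ n ≠ 1) (h : ∀ i, f (i + 1) = x * f i)
    (i : ZMod n) : f i = 0 := by
  have hk : ∀ k : ℕ, f (i + k) = x ^ k * f i := fun k => by
    induction k with
    | zero => simp
    | succ k ih => rw [Nat.cast_succ, ← add_assoc, h, ih, pow_succ']; ring
  have := hk n
  rw [ZMod.natCast_self, add_zero] at this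
  by_contra h0
  exact hx (mul_right_cancel₀ h0 (by rw [one_mul, ← this]))

/-- The deformed Cartan matrix is invertible: it factors as
`𝔮^{-r} (1 - q₃^{-r} S) (1 - q₁^{-r} S⁻¹)` with the cyclic shift `S`, and `q₁`, `q₃` are not roots of unity. -/
lemma isUnit_defCartan [NeZero n] (hn : 2 < n) (h𝔮 : 𝔮 ≠ 0) (h𝔡 : 𝔡 ≠ 0)
    (h1 : ∀ r : ℕ, 0 < r → q1 𝔮 𝔡 ^ r ≠ 1) (h2 : ∀ r : ℕ, 0 < r → q2 𝔮 ^ r ≠ 1)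
    (h3 : ∀ r : ℕ, 0 < r → q3 𝔮 𝔡 ^ r ≠ 1) {r : ℕ} (hr : 0 < r) :
    IsUnit (defCartan n 𝔮 𝔡 r) := by
  have hr' := qInt_ne_zero h𝔮 h2 hr
  have hq : 𝔮 ^ r ≠ 0 := pow_ne_zero _ h𝔮
  have hd : 𝔡 ^ r ≠ 0 := pow_ne_zero _ h𝔡
  rw [← Matrix.mulVec_injective_iff_isUnit]
  refine (injective_iff_map_eq_zero (Matrix.mulVecLin (defCartan n 𝔮 𝔡 r))).2 fun v hv => ?_
  have hv' : ∀ i, (𝔮 ^ r + (𝔮 ^ r)⁻¹) * v i - (𝔡 ^ r)⁻¹ * v (i - 1) - 𝔡 ^ r * v (i + 1) = 0 := by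
    intro i
    have := congrFun hv i
    simpa [Matrix.mulVec, dotProduct, defCartan_apply hn hr', sub_mul, ite_mul,
      Finset.sum_sub_distrib] using this
  -- the factor `1 - q₁^{-r} S⁻¹` is injective, then the factor `1 - q₃^{-r} S`
  have hu : ∀ i, v i - 𝔮 ^ r * 𝔡 ^ r * v (i + 1) = 0 := by
    refine eq_zero_of_shift (f := fun i => v i - 𝔮 ^ r * 𝔡 ^ r * v (i + 1))
      (x := 𝔮 ^ r * (𝔡 ^ r)⁻¹) ?_ ?_
    · have := h1 (r * n) (Nat.mul_pos hr (by omega))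
      intro h
      refine this ?_
      rw [q1, pow_mul, ← inv_inj, inv_one, ← h, ← inv_pow, mul_pow, mul_inv, inv_pow, inv_inv]
      ring
    · intro i
      have := hv' (i + 1)
      rw [add_sub_cancel_right] at this
      field_simp at this ⊢
      linear_combination this
  funext i
  refine eq_zero_of_shift (f := v) (x := (𝔮 ^ r * 𝔡 ^ r)⁻¹) ?_ ?_ i
  · have := h3 (r * n) (Nat.mul_pos hr (by omega))
    intro h
    refine this ?_
    rw [q3, pow_mul, ← h, mul_pow, inv_pow, inv_pow, mul_inv, mul_comm]
  · intro i
    have := hu i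
    field_simp
    linear_combination -this

end Cartan

/-! ### The Heisenberg algebra -/

section Heisenberg

variable {K : Type*} [Field K] {n : ℕ} {𝔮 𝔡 : K}

/-- The commutator of `A` and `B` is the scalar `c`. -/
def HasCommutator {R : Type*} [Ring R] [Algebra K R] (A B : R) (c : K) : Prop :=
  A * B = B * A + c • 1

section

variable {R : Type*} [Ring R] [Algebra K R] {A A' B B' : R} {c c' : K}

lemma HasCommutator.add_left (h : HasCommutator A B c) (h' : HasCommutator A' B c') :
    HasCommutator (A + A') B (c + c') := by
  unfold HasCommutator at *
  rw [add_mul, h, h', mul_add, add_smul]; abel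

lemma HasCommutator.add_right (h : HasCommutator A B c) (h' : HasCommutator A B' c') :
    HasCommutator A (B + B') (c + c') := by
  unfold HasCommutator at *
  rw [mul_add, h, h', add_mul, add_smul]; abel

lemma HasCommutator.smul_left (h : HasCommutator A B c) (a : K) :
    HasCommutator (a • A) B (a * c) := by
  unfold HasCommutator at *
  rw [smul_mul_assoc, h, smul_add, mul_smul_comm, mul_smul]

lemma HasCommutator.smul_right (h : HasCommutator A B c) (a : K) :
    HasCommutator A (a • B) (a * c) := by
  unfold HasCommutator at *
  rw [mul_smul_comm, h, smul_add, smul_mul_assoc, mul_smul]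

lemma HasCommutator.sum_left {ι : Type*} {s : Finset ι} {A : ι → R} {c : ι → K}
    (h : ∀ i, HasCommutator (A i) B (c i)) :
    HasCommutator (∑ i ∈ s, A i) B (∑ i ∈ s, c i) := by
  unfold HasCommutator at *
  simp only [Finset.sum_mul, Finset.mul_sum, h, Finset.sum_add_distrib, Finset.sum_smul]

lemma HasCommutator.sum_right {ι : Type*} {s : Finset ι} {B : ι → R} {c : ι → K}
    (h : ∀ i, HasCommutator A (B i) (c i)) :
    HasCommutator A (∑ i ∈ s, B i) (∑ i ∈ s, c i) := by
  unfold HasCommutator at *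
  simp only [Finset.sum_mul, Finset.mul_sum, h, Finset.sum_add_distrib, Finset.sum_smul]

end

/-- The span of the annihilation modes of degree `r ≥ 1`; the variables `X (j, r - 1)` have weight
`r`. -/
noncomputable def annihilators (n : ℕ) (K : Type*) [Field K] (r : ℕ) :
    Submodule K (Module.End K (Fock n K)) :=
  Submodule.span K (Set.range fun j : ZMod n =>
    (MvPolynomial.pderiv (R := K) (j, r - 1)).toLinearMap)

/-- The span of the creation modes of degree `r ≥ 1`. -/
noncomputable def creators (n : ℕ) (K : Type*) [Field K] (r : ℕ) :
    Submodule K (Module.End K (Fock n K)) :=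
  Submodule.span K (Set.range fun j : ZMod n =>
    LinearMap.mulLeft K (MvPolynomial.X (j, r - 1) : Fock n K))

lemma heis_mem_annihilators [NeZero n] (i : ZMod n) {r : ℕ} (hr : 0 < r) :
    heis n 𝔮 𝔡 i r ∈ annihilators n K r := by
  obtain ⟨m, rfl⟩ : ∃ m, r = m + 1 := ⟨r - 1, by omega⟩
  exact Submodule.sum_mem _ fun j _ => Submodule.smul_mem _ _ (Submodule.subset_span ⟨j, rfl⟩)

lemma heis_mem_creators [NeZero n] (i : ZMod n) {r : ℕ} (hr : 0 < r) :
    heis n 𝔮 𝔡 i (-(r : ℤ)) ∈ creators n K r := by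
  obtain ⟨m, rfl⟩ : ∃ m, r = m + 1 := ⟨r - 1, by omega⟩
  exact Submodule.subset_span ⟨i, rfl⟩

lemma dualHeis_mem_annihilators [NeZero n] (i : ZMod n) {r : ℕ} (hr : 0 < r) :
    dualHeis n 𝔮 𝔡 i r ∈ annihilators n K r :=
  Submodule.smul_mem _ _ (Submodule.sum_mem _ fun j _ =>
    Submodule.smul_mem _ _ (heis_mem_annihilators j hr))

lemma dualHeis_mem_creators [NeZero n] (i : ZMod n) {r : ℕ} (hr : 0 < r) :
    dualHeis n 𝔮 𝔡 i (-(r : ℤ)) ∈ creators n K r :=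
  Submodule.smul_mem _ _ (Submodule.sum_mem _ fun j _ =>
    Submodule.smul_mem _ _ (heis_mem_creators j hr))

lemma commute_of_mem_span {R : Type*} [Ring R] [Algebra K R] {S T : Set R}
    (h : ∀ x ∈ S, ∀ y ∈ T, Commute x y) {A B : R} (hA : A ∈ Submodule.span K S)
    (hB : B ∈ Submodule.span K T) : Commute A B := by
  induction hA, hB using Submodule.span_induction₂ with
  | mem_mem x y hx hy => exact h x hx y hy
  | zero_left y hy => exact Commute.zero_left y
  | zero_right x hx => exact Commute.zero_right x
  | add_left x y z _ _ _ h1 h2 => exact h1.add_left h2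
  | add_right x y z _ _ _ h1 h2 => exact h1.add_right h2
  | smul_left r x y _ _ h1 => exact h1.smul_left r
  | smul_right r x y _ _ h1 => exact h1.smul_right r

lemma commute_of_mem_annihilators {r s : ℕ} {A B : Module.End K (Fock n K)}
    (hA : A ∈ annihilators n K r) (hB : B ∈ annihilators n K s) : Commute A B := by
  refine commute_of_mem_span ?_ hA hB
  rintro _ ⟨i, rfl⟩ _ ⟨j, rfl⟩
  -- the commutator is a derivation that kills the variables
  have : ⁅MvPolynomial.pderiv (R := K) (i, r - 1),
      MvPolynomial.pderiv (R := K) (j, s - 1)⁆ = 0 := by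
    ext x
    simp [Derivation.commutator_apply, MvPolynomial.pderiv_X, Pi.single_apply, apply_ite]
  refine LinearMap.ext fun v => sub_eq_zero.1 ?_
  have := congrArg (fun D => D v) this
  simpa [Derivation.commutator_apply] using this

lemma commute_of_mem_annihilators_creators {r s : ℕ} (hr : 0 < r) (hs : 0 < s) (hrs : r ≠ s)
    {A B : Module.End K (Fock n K)} (hA : A ∈ annihilators n K r) (hB : B ∈ creators n K s) :
    Commute A B := by
  refine commute_of_mem_span ?_ hA hB
  rintro _ ⟨i, rfl⟩ _ ⟨j, rfl⟩
  refine LinearMap.ext fun v => ?_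
  have hne : (j, s - 1) ≠ (i, r - 1) := fun h => hrs (by
    have := congrArg Prod.snd h
    simp only at this
    omega)
  simp [MvPolynomial.pderiv_X_of_ne hne, mul_comm]

lemma lowersWeight_of_mem_annihilators {r : ℕ} (hr : 0 < r) {A : Module.End K (Fock n K)}
    (hA : A ∈ annihilators n K r) : LowersWeight r A := by
  induction hA using Submodule.span_induction with
  | mem x hx =>
    obtain ⟨j, rfl⟩ := hx
    have := lowersWeight_pderiv (K := K) j (r - 1)
    rwa [Nat.sub_add_cancel hr] at this
  | zero => exact LowersWeight.zero r
  | add x y _ _ hx hy => exact hx.add hy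
  | smul a x _ hx => exact hx.smul a

lemma isVertexExponent_of_mem {J : Exponent n K}
    (h : ∀ r : ℕ, 0 < r → J r ∈ annihilators n K r) : IsVertexExponent J where
  commute r s hr hs := commute_of_mem_annihilators (h r hr) (h s hs)
  lowers r hr := lowersWeight_of_mem_annihilators hr (h r hr)

/-- `[H_{i,r}, H_{j,-r}] = ([r]²/r) C^{[r]}_{ij}`. -/
lemma heis_heis [NeZero n] (i j : ZMod n) {r : ℕ} (hr : 0 < r) :
    HasCommutator (heis n 𝔮 𝔡 i r) (heis n 𝔮 𝔡 j (-(r : ℤ)))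
      (qInt 𝔮 r ^ 2 / r * defCartan n 𝔮 𝔡 r i j) := by
  obtain ⟨m, rfl⟩ : ∃ m, r = m + 1 := ⟨r - 1, by omega⟩
  have h : ∀ k : ZMod n, HasCommutator (MvPolynomial.pderiv (R := K) (k, m)).toLinearMap
      (LinearMap.mulLeft K (MvPolynomial.X (j, m) : Fock n K)) (if k = j then (1 : K) else 0) := by
    intro k
    refine LinearMap.ext fun v => ?_
    by_cases hk : k = j
    · subst hk
      simp [mul_comm, add_comm]
    · have hne : (j, m) ≠ (k, m) := fun h => hk (congrArg Prod.fst h).symm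
      simp [MvPolynomial.pderiv_X_of_ne hne, mul_comm, hk]
  have := HasCommutator.sum_left (s := Finset.univ) fun k => (h k).smul_left
    (qInt 𝔮 (m + 1) ^ 2 / ((m : K) + 1) * defCartan n 𝔮 𝔡 (m + 1) i k)
  simp only [mul_ite, mul_one, mul_zero, Finset.sum_ite_eq', Finset.mem_univ, if_true] at this
  rw [Nat.cast_succ (R := K)]
  exact this

end Heisenberg

section DualHeisenberg

variable {K : Type*} [Field K] {n : ℕ} [NeZero n] {𝔮 𝔡 : K}

/-- `[Λ_{i,r}, H_{j,-r}] = δ_{ij} [r]/r`. -/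
lemma dualHeis_heis {r : ℕ} (hr : 0 < r) (hr' : qInt 𝔮 r ≠ 0)
    (hC : IsUnit (defCartan n 𝔮 𝔡 r)) (i j : ZMod n) :
    HasCommutator (dualHeis n 𝔮 𝔡 i r) (heis n 𝔮 𝔡 j (-(r : ℤ)))
      (if i = j then qInt 𝔮 r / r else 0) := by
  have h := (HasCommutator.sum_left (s := Finset.univ) fun k =>
    (heis_heis (𝔮 := 𝔮) (𝔡 := 𝔡) k j hr).smul_left (invCartan n 𝔮 𝔡 r i k)).smul_left (qInt 𝔮 r)⁻¹
  have hb : ∑ k, invCartan n 𝔮 𝔡 r i k * defCartan n 𝔮 𝔡 r k j = if i = j then 1 else 0 := by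
    rw [← Matrix.mul_apply, invCartan,
      Matrix.nonsing_inv_mul _ ((Matrix.isUnit_iff_isUnit_det _).1 hC), Matrix.one_apply]
  rw [dualHeis]
  convert h using 1
  rw [Finset.sum_congr rfl fun k _ => mul_left_comm _ _ _, ← Finset.mul_sum, hb]
  split_ifs
  · field_simp
  · simp

/-- `[H_{i,r}, Λ_{j,-r}] = -δ_{ij} [r]/r`. -/
lemma heis_dualHeis (hn : 2 < n) {r : ℕ} (hr : 0 < r) (hr' : qInt 𝔮 r ≠ 0)
    (hC : IsUnit (defCartan n 𝔮 𝔡 r)) (i j : ZMod n) :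
    HasCommutator (heis n 𝔮 𝔡 i r) (dualHeis n 𝔮 𝔡 j (-(r : ℤ)))
      (-if i = j then qInt 𝔮 r / r else 0) := by
  have h := (HasCommutator.sum_right (s := Finset.univ) fun k =>
    (heis_heis (𝔮 := 𝔮) (𝔡 := 𝔡) i k hr).smul_right
      (invCartan n 𝔮 𝔡 (-(r : ℤ)) j k)).smul_right (qInt 𝔮 (-(r : ℤ)))⁻¹
  have hb : ∑ k, invCartan n 𝔮 𝔡 (-(r : ℤ)) j k * defCartan n 𝔮 𝔡 r i k =
      if i = j then 1 else 0 := by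
    rw [invCartan, defCartan_neg hn hr', ← Matrix.transpose_nonsing_inv,
      Finset.sum_congr rfl fun k _ => mul_comm _ _]
    simp only [Matrix.transpose_apply]
    rw [← Matrix.mul_apply, Matrix.mul_nonsing_inv _ ((Matrix.isUnit_iff_isUnit_det _).1 hC),
      Matrix.one_apply]
  rw [dualHeis]
  convert h using 1
  rw [Finset.sum_congr rfl fun k _ => mul_left_comm _ _ _, ← Finset.mul_sum, hb, qInt_neg]
  split_ifs
  · field_simp
  · simp

/-- `[Λ_{i,r}, Λ_{j,-r}] = -b^{[r]}_{ij}/r`. -/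
lemma dualHeis_dualHeis (hn : 2 < n) {r : ℕ} (hr : 0 < r) (hr' : qInt 𝔮 r ≠ 0)
    (hC : IsUnit (defCartan n 𝔮 𝔡 r)) (i j : ZMod n) :
    HasCommutator (dualHeis n 𝔮 𝔡 i r) (dualHeis n 𝔮 𝔡 j (-(r : ℤ)))
      (-(invCartan n 𝔮 𝔡 r i j / r)) := by
  have h := (HasCommutator.sum_left (s := Finset.univ) fun k =>
    (heis_dualHeis (𝔮 := 𝔮) (𝔡 := 𝔡) hn hr hr' hC k j).smul_left
      (invCartan n 𝔮 𝔡 r i k)).smul_left (qInt 𝔮 r)⁻¹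
  rw [dualHeis.eq_def _ _ _ _ (r : ℤ)]
  convert h using 1
  simp only [mul_neg, mul_ite, mul_zero, Finset.sum_neg_distrib, Finset.sum_ite_eq',
    Finset.mem_univ, if_true]
  field_simp

end DualHeisenberg

/-! ### The operator product factor of the intertwiners -/

section Intertwiner

variable {K : Type*} [Field K] {n : ℕ} [NeZero n] {𝔰 𝔮 𝔡 : K}

lemma intertwiner_mem_annihilators (lam : YoungDiagram) {r : ℕ} (hr : 0 < r) :
    intertwiner n 𝔰 𝔮 𝔡 lam r ∈ annihilators n K r := by
  have h1 := fun i => heis_mem_annihilators (n := n) (𝔮 := 𝔮) (𝔡 := 𝔡) i hr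
  have h2 := dualHeis_mem_annihilators (n := n) (𝔮 := 𝔮) (𝔡 := 𝔡) 0 hr
  simp only [intertwiner, Pi.add_apply, Finset.sum_apply, scale, eta, vMinus, vPlus,
    vacuumIntertwiner, Pi.sub_apply, dualVMinus, dualVPlus, Int.natCast_pos, hr, if_true,
    (show ¬ (r : ℤ) < 0 by omega), if_false, smul_zero, zero_add, zero_sub]
  refine Submodule.add_mem _ (Submodule.sum_mem _ fun s _ => ?_) ?_
  · exact Submodule.smul_mem _ _ (Submodule.smul_mem _ _ (Submodule.neg_mem _
      (Submodule.smul_mem _ _ (h1 _))))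
  · exact Submodule.neg_mem _ (Submodule.smul_mem _ _ (Submodule.neg_mem _ h2))

/-- The annihilation modes of `Φ*_μ`. -/
lemma dualIntertwiner_apply (mu : YoungDiagram) {r : ℕ} (hr : 0 < r) :
    dualIntertwiner n 𝔰 𝔮 𝔡 mu r =
      ∑ t ∈ mu.cells, ((boxWeight 𝔮 𝔡 t)⁻¹ ^ r * 𝔰 ^ r * (qInt 𝔮 r)⁻¹) •
        heis n 𝔮 𝔡 (color n t) r + (-(𝔰 ^ r)⁻¹) • dualHeis n 𝔮 𝔡 0 r := by
  simp only [dualIntertwiner, Pi.add_apply, Finset.sum_apply, scale, xi, vMinus, vPlus,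
    Pi.neg_apply, vacuumDualIntertwiner, Pi.sub_apply, dualVMinus, dualVPlus, Int.natCast_pos, hr,
    if_true, (show ¬ (r : ℤ) < 0 by omega), if_false, smul_zero, neg_zero, zero_add, zero_sub, smul_neg,
    neg_neg, zpow_neg, zpow_natCast, inv_pow, inv_inv, smul_smul]
  simp only [mul_assoc]
  exact congrArg _ (neg_smul _ _).symm

lemma dualIntertwiner_mem_annihilators (mu : YoungDiagram) {r : ℕ} (hr : 0 < r) :
    dualIntertwiner n 𝔰 𝔮 𝔡 mu r ∈ annihilators n K r := by
  rw [dualIntertwiner_apply mu hr]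
  exact Submodule.add_mem _ (Submodule.sum_mem _ fun t _ => Submodule.smul_mem _ _
    (heis_mem_annihilators _ hr)) (Submodule.smul_mem _ _ (dualHeis_mem_annihilators _ hr))

/-- The creation modes of `Φ^λ`. -/
lemma intertwiner_apply_neg (lam : YoungDiagram) {r : ℕ} (hr : 0 < r) :
    intertwiner n 𝔰 𝔮 𝔡 lam (-(r : ℤ)) =
      ∑ s ∈ lam.cells, (boxWeight 𝔮 𝔡 s ^ r * (𝔰 ^ r)⁻¹ * (qInt 𝔮 r)⁻¹) •
        heis n 𝔮 𝔡 (color n s) (-(r : ℤ)) + 𝔰 ^ r • dualHeis n 𝔮 𝔡 0 (-(r : ℤ)) := by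
  simp only [intertwiner, Pi.add_apply, Finset.sum_apply, scale, eta, vMinus, vPlus,
    vacuumIntertwiner, Pi.sub_apply, dualVMinus, dualVPlus,
    (show ¬ 0 < -(r : ℤ) by omega), (show -(r : ℤ) < 0 by omega), if_true, if_false, smul_zero,
    add_zero, sub_zero, neg_neg, zpow_natCast, inv_pow, smul_smul]
  simp only [mul_assoc]

/-- The scalar `r c_r`, where `c_r` is the commutator of the modes of degree `r` of `Φ*_μ` and `-r`
of `Φ^λ`. -/
noncomputable def opeScalar (n : ℕ) [NeZero n] (𝔮 𝔡 : K) (lam mu : YoungDiagram) (r : ℕ) : K :=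
  ∑ t ∈ mu.cells, ∑ s ∈ lam.cells,
      (boxWeight 𝔮 𝔡 s / boxWeight 𝔮 𝔡 t) ^ r * defCartan n 𝔮 𝔡 r (color n t) (color n s) -
    ∑ t ∈ mu.cells, (if color n t = 0 then (𝔮 / boxWeight 𝔮 𝔡 t) ^ r else 0) -
    ∑ s ∈ lam.cells, (if color n s = 0 then (boxWeight 𝔮 𝔡 s / 𝔮) ^ r else 0) +
    invCartan n 𝔮 𝔡 r 0 0

lemma hasCommutator_intertwiners (hn : 2 < n) (h𝔰 : 𝔰 ^ 2 = 𝔮) (h𝔮 : 𝔮 ≠ 0)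
    [CharZero K] {r : ℕ} (hr : 0 < r) (hr' : qInt 𝔮 r ≠ 0)
    (hC : IsUnit (defCartan n 𝔮 𝔡 r)) (lam mu : YoungDiagram) :
    HasCommutator (dualIntertwiner n 𝔰 𝔮 𝔡 mu r) (intertwiner n 𝔰 𝔮 𝔡 lam (-(r : ℤ)))
      (opeScalar n 𝔮 𝔡 lam mu r / r) := by
  have hs : 𝔰 ≠ 0 := by rintro rfl; exact h𝔮 (by simp [← h𝔰])
  have hr0 : (r : K) ≠ 0 := Nat.cast_ne_zero.2 hr.ne'
  have hsr : (𝔰 ^ r) ≠ 0 := pow_ne_zero _ hs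
  have hq : 𝔮 ^ r = 𝔰 ^ r * 𝔰 ^ r := by rw [← h𝔰, ← pow_mul, ← pow_add, two_mul]
  rw [dualIntertwiner_apply mu hr, intertwiner_apply_neg lam hr]
  have hHJ : ∀ i, HasCommutator (heis n 𝔮 𝔡 i r) _ _ := fun i =>
    (HasCommutator.sum_right (s := lam.cells) fun s =>
      (heis_heis (𝔮 := 𝔮) (𝔡 := 𝔡) i (color n s) hr).smul_right
        (boxWeight 𝔮 𝔡 s ^ r * (𝔰 ^ r)⁻¹ * (qInt 𝔮 r)⁻¹)).add_right
    ((heis_dualHeis hn hr hr' hC i 0).smul_right (𝔰 ^ r))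
  have hLJ := (HasCommutator.sum_right (s := lam.cells) fun s =>
      (dualHeis_heis (𝔮 := 𝔮) (𝔡 := 𝔡) hr hr' hC 0 (color n s)).smul_right
        (boxWeight 𝔮 𝔡 s ^ r * (𝔰 ^ r)⁻¹ * (qInt 𝔮 r)⁻¹)).add_right
    ((dualHeis_dualHeis hn hr hr' hC 0 0).smul_right (𝔰 ^ r))
  have h := (HasCommutator.sum_left (s := mu.cells) fun t =>
      (hHJ (color n t)).smul_left
        ((boxWeight 𝔮 𝔡 t)⁻¹ ^ r * 𝔰 ^ r * (qInt 𝔮 r)⁻¹)).add_left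
    (hLJ.smul_left (-(𝔰 ^ r)⁻¹))
  convert h using 1
  rw [opeScalar, div_eq_iff hr0, add_mul, Finset.sum_mul, mul_add, add_mul, sub_eq_add_neg,
    sub_eq_add_neg, ← Finset.sum_neg_distrib, ← Finset.sum_add_distrib, add_assoc]
  congr 1
  · refine Finset.sum_congr rfl fun t _ => ?_
    rw [mul_add, add_mul, Finset.mul_sum, Finset.sum_mul]
    congr 1
    · refine Finset.sum_congr rfl fun s _ => ?_
      rw [div_pow, inv_pow]
      field_simp
    · split_ifs
      · rw [div_pow, inv_pow, hq]
        field_simp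
      · simp
  · congr 1
    · rw [Finset.mul_sum, Finset.sum_mul, ← Finset.sum_neg_distrib]
      refine Finset.sum_congr rfl fun s _ => ?_
      simp only [eq_comm (a := (0 : ZMod n))]
      split_ifs
      · rw [div_pow, hq]
        field_simp
      · simp
    · field_simp

/-- The operator product factor of the intertwiners exists, and it is the solution of
`X G' = (∑ 𝔮^r r c_r X^r) G` with constant term `1`. -/
theorem exists_isOPEFactor [CharZero K] (hn : 2 < n) (h𝔰 : 𝔰 ^ 2 = 𝔮) (h𝔮 : 𝔮 ≠ 0) (h𝔡 : 𝔡 ≠ 0)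
    (h1 : ∀ r : ℕ, 0 < r → q1 𝔮 𝔡 ^ r ≠ 1) (h2 : ∀ r : ℕ, 0 < r → q2 𝔮 ^ r ≠ 1)
    (h3 : ∀ r : ℕ, 0 < r → q3 𝔮 𝔡 ^ r ≠ 1) (lam mu : YoungDiagram) :
    ∃ G : K⟦X⟧, IsOPEFactor n 𝔰 𝔮 𝔡 lam mu G ∧ PowerSeries.coeff 0 G = 1 ∧
      euler G = (PowerSeries.mk fun r =>
        if r = 0 then 0 else 𝔮 ^ r * opeScalar n 𝔮 𝔡 lam mu r) * G := by
  obtain ⟨g, hg0, hg⟩ := exists_euler_eq_mul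
    (P := PowerSeries.mk fun r => (r : K) * (opeScalar n 𝔮 𝔡 lam mu r / r)) (by simp)
  have hres : ∀ A : K⟦X⟧, euler (PowerSeries.rescale 𝔮 A) = PowerSeries.rescale 𝔮 (euler A) :=
    fun A => by ext m; simp [mul_left_comm]
  refine ⟨PowerSeries.rescale 𝔮 g, ?_, ?_, ?_⟩
  · rw [IsOPEFactor, PowerSeries.rescale_rescale, mul_inv_cancel₀ h𝔮, PowerSeries.rescale_one]
    refine isOPE_of_commutator
      (isVertexExponent_of_mem fun r => dualIntertwiner_mem_annihilators mu)
      (isVertexExponent_of_mem fun r => intertwiner_mem_annihilators lam) ?_ hg0 hg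
    intro r s hr hs
    split_ifs with hsr
    · subst hsr
      exact hasCommutator_intertwiners hn h𝔰 h𝔮 hr (qInt_ne_zero h𝔮 h2 hr)
        (isUnit_defCartan hn h𝔮 h𝔡 h1 h2 h3 hr) lam mu
    · rw [add_zero]
      refine (commute_of_mem_annihilators_creators hr hs (Ne.symm hsr)
        (dualIntertwiner_mem_annihilators mu hr) ?_).eq
      rw [intertwiner_apply_neg lam hs]
      exact Submodule.add_mem _ (Submodule.sum_mem _ fun t _ => Submodule.smul_mem _ _
        (heis_mem_creators _ hs)) (Submodule.smul_mem _ _ (dualHeis_mem_creators _ hs))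
  · simpa using hg0
  · rw [hres, hg, map_mul]
    congr 1
    ext r
    rcases eq_or_ne r 0 with rfl | hr
    · simp
    · simp [hr, mul_div_cancel₀]

lemma IsOPEFactor.unique [CharZero K] (h𝔮 : 𝔮 ≠ 0) {lam mu : YoungDiagram} {G G' : K⟦X⟧}
    (h : IsOPEFactor n 𝔰 𝔮 𝔡 lam mu G) (h' : IsOPEFactor n 𝔰 𝔮 𝔡 lam mu G') : G = G' := by
  have := congrArg (PowerSeries.rescale 𝔮) (IsOPE.unique
    (isVertexExponent_of_mem fun r => dualIntertwiner_mem_annihilators mu)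
    (isVertexExponent_of_mem fun r => intertwiner_mem_annihilators lam) h h')
  simpa [PowerSeries.rescale_rescale, h𝔮] using this

end Intertwiner

/-! ### The character of the Nekrasov factor -/

section Character

variable {M : Type*} [AddCommGroup M]

/-- The sum of `f a b` over the weights `u p₁^a p₃^b` of the factors of the Nekrasov factor, before
the restriction to weights with `b ≡ a` modulo `n`. -/
def nekrasovSum (f : ℤ → ℤ → M) (lam mu : YoungDiagram) : M :=
  ∑ s ∈ lam.cells, f (arm lam s) (-leg mu s - 1) + ∑ t ∈ mu.cells, f (-arm mu t - 1) (leg lam t)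

/-- The sum of `f a b` over the weights `q₁^a q₃^b` in the character
`∑_{t ∈ μ} q₂ χ_t⁻¹ + ∑_{s ∈ λ} χ_s - (1 - q₁⁻¹) (1 - q₃⁻¹) ∑_{s,t} χ_s χ_t⁻¹`,
where `χ_s` is the weight of the box `s`. -/
def contractionSum (f : ℤ → ℤ → M) (lam mu : YoungDiagram) : M :=
  ∑ t ∈ mu.cells, f (-1 - t.2) (-1 - t.1) + ∑ s ∈ lam.cells, f s.2 s.1 -
    ∑ t ∈ mu.cells, ∑ s ∈ lam.cells,
      (f ((s.2 : ℤ) - t.2) ((s.1 : ℤ) - t.1) - f ((s.2 : ℤ) - t.2 - 1) ((s.1 : ℤ) - t.1) -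
        f ((s.2 : ℤ) - t.2) ((s.1 : ℤ) - t.1 - 1) + f ((s.2 : ℤ) - t.2 - 1) ((s.1 : ℤ) - t.1 - 1))

/-- The sum of `f a b` over the weights in the numerator of the recursion, minus the sum over those
in the denominator, for a box added in row `j` and column `m` (counted from `0`). -/
def recursionSum (f : ℤ → ℤ → M) (lam : YoungDiagram) (j m : ℕ) : M :=
  ∑ i ∈ Finset.range (lam.colLen 0 + 1), f ((lam.rowLen i : ℤ) - m - 1) ((i : ℤ) - j - 1) -
    ∑ i ∈ Finset.range (lam.colLen 0), f ((lam.rowLen i : ℤ) - m - 1) ((i : ℤ) - j)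

lemma sum_cells_eq_sum_rows (lam : YoungDiagram) (F : ℕ × ℕ → M) :
    ∑ s ∈ lam.cells, F s =
      ∑ i ∈ Finset.range (lam.colLen 0), ∑ k ∈ Finset.range (lam.rowLen i), F (i, k) := by
  rw [Finset.sum_sigma']
  refine Finset.sum_bij' (fun s _ => ⟨s.1, s.2⟩) (fun x _ => (x.1, x.2)) ?_ ?_ ?_ ?_ ?_
  · rintro ⟨i, k⟩ hs
    rw [YoungDiagram.mem_cells] at hs
    simp only [Finset.mem_sigma, Finset.mem_range]
    exact ⟨YoungDiagram.mem_iff_lt_colLen.1 (lam.up_left_mem le_rfl k.zero_le hs),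
      YoungDiagram.mem_iff_lt_rowLen.1 hs⟩
  · rintro ⟨i, k⟩ hs
    simp only [Finset.mem_sigma, Finset.mem_range] at hs
    exact YoungDiagram.mem_iff_lt_rowLen.2 hs.2
  all_goals simp

lemma rowLen_colLen_zero (lam : YoungDiagram) : lam.rowLen (lam.colLen 0) = 0 := by
  by_contra h
  exact lt_irrefl _ (YoungDiagram.mem_iff_lt_colLen.1
    (YoungDiagram.mem_iff_lt_rowLen.2 (Nat.pos_of_ne_zero h)))

lemma rowLen_of_colLen_le {lam : YoungDiagram} {i m : ℕ} (h1 : lam.colLen (m + 1) ≤ i)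
    (h2 : i < lam.colLen m) : lam.rowLen i = m + 1 := by
  refine le_antisymm ?_ (YoungDiagram.mem_iff_lt_rowLen.1 (YoungDiagram.mem_iff_lt_colLen.2 h2))
  by_contra h
  exact absurd (YoungDiagram.mem_iff_lt_colLen.1 (YoungDiagram.mem_iff_lt_rowLen.2 (not_le.1 h)))
    (not_lt.2 h1)

/-- Two ways of summing along the boundary of a Young diagram from its bottom up to column `m`: over
the rows, which are those from `colLen m` on, and over the columns. -/
lemma sum_boundary (lam : YoungDiagram) (φ : ℕ → ℕ → M) (m : ℕ) :
    ∑ i ∈ Finset.Ico (lam.colLen m) (lam.colLen 0 + 1), φ (lam.rowLen i) i -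
        ∑ i ∈ Finset.Ico (lam.colLen m) (lam.colLen 0), φ (lam.rowLen i) (i + 1) =
      ∑ k ∈ Finset.range (m + 1), φ k (lam.colLen k) -
        ∑ k ∈ Finset.range m, φ (k + 1) (lam.colLen k) := by
  induction m with
  | zero => simp [rowLen_colLen_zero]
  | succ m ih =>
    have h1 : lam.colLen (m + 1) ≤ lam.colLen m := lam.colLen_anti _ _ m.le_succ
    have h2 : lam.colLen m ≤ lam.colLen 0 := lam.colLen_anti _ _ m.zero_le
    -- the rows that end exactly at the end of column `m`
    have h3 : ∀ g : ℕ → ℕ, ∑ i ∈ Finset.Ico (lam.colLen (m + 1)) (lam.colLen m),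
        φ (lam.rowLen i) (g i) = ∑ i ∈ Finset.Ico (lam.colLen (m + 1)) (lam.colLen m),
        φ (m + 1) (g i) := fun g => Finset.sum_congr rfl fun i hi => by
      rw [rowLen_of_colLen_le (Finset.mem_Ico.1 hi).1 (Finset.mem_Ico.1 hi).2]
    have h4 := Finset.sum_Ico_sub (φ (m + 1)) h1
    rw [Finset.sum_sub_distrib] at h4
    rw [← Finset.sum_Ico_consecutive _ h1 (h2.trans (Nat.le_add_right _ 1)),
      ← Finset.sum_Ico_consecutive _ h1 h2, h3 fun i => i, h3 fun i => i + 1,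
      Finset.sum_range_succ _ (m + 1), Finset.sum_range_succ (fun k => φ (k + 1) _) m]
    have h5 := congrArg₂ (· - ·) ih h4
    rw [← sub_eq_zero] at h5 ⊢
    rw [← h5]
    abel

lemma add_one_sub_sub_one (a b : ℤ) : a + 1 - b - 1 = a - b := by ring

lemma IsAddBox.mem {mu mu' : YoungDiagram} {j : ℕ} (h : IsAddBox mu mu' j) (s : ℕ × ℕ) :
    s ∈ mu' ↔ s = (j, mu.rowLen j) ∨ s ∈ mu := by
  rw [← YoungDiagram.mem_cells, h, Finset.mem_insert, YoungDiagram.mem_cells]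

lemma IsAddBox.notMem {mu mu' : YoungDiagram} {j : ℕ} (_ : IsAddBox mu mu' j) :
    (j, mu.rowLen j) ∉ mu.cells := fun h =>
  lt_irrefl _ (YoungDiagram.mem_iff_lt_rowLen.1 ((YoungDiagram.mem_cells _).1 h))

lemma IsAddBox.colLen_self {mu mu' : YoungDiagram} {j : ℕ} (h : IsAddBox mu mu' j) :
    mu.colLen (mu.rowLen j) = j := by
  refine le_antisymm ?_ ?_
  · by_contra hlt
    exact h.notMem ((YoungDiagram.mem_cells _).2 (YoungDiagram.mem_iff_lt_colLen.2 (not_le.1 hlt)))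
  · by_contra hlt
    rw [not_le] at hlt
    have h1 : (mu.colLen (mu.rowLen j), mu.rowLen j) ∈ mu' :=
      mu'.up_left_mem hlt.le le_rfl ((h.mem _).2 (Or.inl rfl))
    rcases (h.mem _).1 h1 with h2 | h2
    · exact hlt.ne (congrArg Prod.fst h2)
    · exact lt_irrefl _ (YoungDiagram.mem_iff_lt_colLen.1 h2)

lemma IsAddBox.rowLen {mu mu' : YoungDiagram} {j : ℕ} (h : IsAddBox mu mu' j) (i : ℕ) :
    mu'.rowLen i = mu.rowLen i + if i = j then 1 else 0 := by
  refine eq_of_forall_lt_iff fun a => ?_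
  rw [← YoungDiagram.mem_iff_lt_rowLen, h.mem, YoungDiagram.mem_iff_lt_rowLen, Prod.mk.injEq]
  split_ifs with hi
  · subst hi; omega
  · omega

lemma IsAddBox.colLen {mu mu' : YoungDiagram} {j : ℕ} (h : IsAddBox mu mu' j) (k : ℕ) :
    mu'.colLen k = mu.colLen k + if k = mu.rowLen j then 1 else 0 := by
  refine eq_of_forall_lt_iff fun a => ?_
  rw [← YoungDiagram.mem_iff_lt_colLen, h.mem, YoungDiagram.mem_iff_lt_colLen, Prod.mk.injEq]
  split_ifs with hk
  · have := h.colLen_self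
    subst hk; omega
  · omega

/-- Adding a box to `μ` changes the legs over its column and the arms in its row only; the sum along
the boundary of `λ` turns the resulting sum over columns of `λ` into one over rows. -/
lemma nekrasovSum_addBox (f : ℤ → ℤ → M) (lam : YoungDiagram) {mu mu' : YoungDiagram} {j : ℕ}
    (h : IsAddBox mu mu' j) :
    nekrasovSum f lam mu' = nekrasovSum f lam mu + recursionSum f lam j (mu.rowLen j) := by
  set m := mu.rowLen j with hm
  let φ : ℕ → ℕ → M := fun a b => f ((a : ℤ) - m - 1) ((b : ℤ) - j - 1)
  have hcol := h.colLen_self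
  rw [← hm] at hcol
  have h1 : ∑ s ∈ lam.cells, f (arm lam s) (-leg mu' s - 1) -
      ∑ s ∈ lam.cells, f (arm lam s) (-leg mu s - 1) =
      ∑ i ∈ Finset.range (lam.colLen m), (φ (lam.rowLen i) i - φ (lam.rowLen i) (i + 1)) := by
    have h0 : ∀ s ∈ lam.cells, f (arm lam s) (-leg mu' s - 1) - f (arm lam s) (-leg mu s - 1) =
        if s.2 = m then φ (lam.rowLen s.1) s.1 - φ (lam.rowLen s.1) (s.1 + 1) else 0 := by
      rintro ⟨i, k⟩ _
      simp only [leg, h.colLen, ← hm, arm, φ]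
      split_ifs with hk
      · subst hk
        rw [hcol]
        push_cast
        congr 2 <;> ring
      · simp
    rw [← Finset.sum_sub_distrib, Finset.sum_congr rfl h0, ← Finset.sum_filter]
    change ∑ s ∈ lam.col m, _ = _
    rw [YoungDiagram.col_eq_prod, Finset.sum_product]
    simp
  have h2 : ∑ t ∈ mu'.cells, f (-arm mu' t - 1) (leg lam t) -
      ∑ t ∈ mu.cells, f (-arm mu t - 1) (leg lam t) =
      ∑ k ∈ Finset.range (m + 1), φ k (lam.colLen k) -
        ∑ k ∈ Finset.range m, φ (k + 1) (lam.colLen k) := by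
    have h0 : ∀ t ∈ mu.cells, f (-arm mu' t - 1) (leg lam t) - f (-arm mu t - 1) (leg lam t) =
        if t.1 = j then φ t.2 (lam.colLen t.2) - φ (t.2 + 1) (lam.colLen t.2) else 0 := by
      rintro ⟨i, k⟩ _
      simp only [leg, h.rowLen, arm, φ]
      split_ifs with hk
      · subst hk
        push_cast
        congr 2 <;> ring
      · simp
    rw [h, Finset.sum_insert h.notMem, add_sub_assoc, ← Finset.sum_sub_distrib,
      Finset.sum_congr rfl h0, ← Finset.sum_filter]
    change _ + ∑ s ∈ mu.row j, _ = _
    rw [YoungDiagram.row_eq_prod, Finset.sum_product, Finset.sum_singleton, Finset.sum_sub_distrib,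
      Finset.sum_range_succ, add_comm, add_sub_right_comm]
    congr 1
    simp only [arm, leg, h.rowLen, if_true, φ, ← hm]
    push_cast
    congr 1 <;> ring
  have h3 := sum_boundary lam φ m
  have h4 : lam.colLen m ≤ lam.colLen 0 := lam.colLen_anti _ _ m.zero_le
  have h5 : recursionSum f lam j m = ∑ i ∈ Finset.range (lam.colLen 0 + 1), φ (lam.rowLen i) i -
      ∑ i ∈ Finset.range (lam.colLen 0), φ (lam.rowLen i) (i + 1) := by
    simp only [recursionSum, φ]
    push_cast
    simp only [add_one_sub_sub_one]
  rw [h5, ← Finset.sum_range_add_sum_Ico _ (h4.trans (Nat.le_add_right _ 1)),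
    ← Finset.sum_range_add_sum_Ico _ h4, nekrasovSum, nekrasovSum]
  rw [← h3, sub_eq_iff_eq_add] at h2
  rw [Finset.sum_sub_distrib, sub_eq_iff_eq_add] at h1
  rw [h1, h2]
  abel

/-- The double sum over the boxes telescopes along the rows of `λ`. -/
lemma contractionSum_addBox (f : ℤ → ℤ → M) (lam : YoungDiagram) {mu mu' : YoungDiagram} {j : ℕ}
    (h : IsAddBox mu mu' j) :
    contractionSum f lam mu' = contractionSum f lam mu + recursionSum f lam j (mu.rowLen j) := by
  set m := mu.rowLen j with hm
  let φ : ℕ → ℕ → M := fun a b => f ((a : ℤ) - m - 1) ((b : ℤ) - j - 1)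
  have h1 : ∑ s ∈ lam.cells,
      (f ((s.2 : ℤ) - m) ((s.1 : ℤ) - j) - f ((s.2 : ℤ) - m - 1) ((s.1 : ℤ) - j) -
        f ((s.2 : ℤ) - m) ((s.1 : ℤ) - j - 1) + f ((s.2 : ℤ) - m - 1) ((s.1 : ℤ) - j - 1)) =
      ∑ i ∈ Finset.range (lam.colLen 0), (φ (lam.rowLen i) (i + 1) - φ (lam.rowLen i) i) -
        (φ 0 (lam.colLen 0) - φ 0 0) := by
    rw [sum_cells_eq_sum_rows, ← Finset.sum_range_sub (φ 0), ← Finset.sum_sub_distrib]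
    refine Finset.sum_congr rfl fun i _ => ?_
    have h2 := Finset.sum_range_sub (fun k => φ k (i + 1)) (lam.rowLen i)
    have h3 := Finset.sum_range_sub (fun k => φ k i) (lam.rowLen i)
    calc _ = (φ (lam.rowLen i) (i + 1) - φ 0 (i + 1)) - (φ (lam.rowLen i) i - φ 0 i) := by
          rw [← h2, ← h3, ← Finset.sum_sub_distrib]
          refine Finset.sum_congr rfl fun k _ => ?_
          simp only [φ]
          push_cast
          simp only [add_one_sub_sub_one]
          abel
      _ = _ := by abel
  have h5 : recursionSum f lam j m = ∑ i ∈ Finset.range (lam.colLen 0), φ (lam.rowLen i) i +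
      φ 0 (lam.colLen 0) - ∑ i ∈ Finset.range (lam.colLen 0), φ (lam.rowLen i) (i + 1) := by
    rw [recursionSum, Finset.sum_range_succ, rowLen_colLen_zero]
    simp only [φ]
    push_cast
    simp only [add_one_sub_sub_one]
  have h6 : f (-1 - (m : ℤ)) (-1 - (j : ℤ)) = φ 0 0 := by
    simp only [φ]
    push_cast
    congr 1 <;> ring
  rw [contractionSum, contractionSum, h, Finset.sum_insert h.notMem, Finset.sum_insert h.notMem,
    ← hm, h1, h5, h6, Finset.sum_sub_distrib]
  abel

/-- Every nonempty Young diagram arises by adding a box to its last row. -/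
lemma exists_isAddBox {mu : YoungDiagram} (h : mu ≠ ⊥) : ∃ nu j, IsAddBox nu mu j := by
  have hpos : 0 < mu.colLen 0 := by
    by_contra h0
    refine h (YoungDiagram.ext (Finset.eq_empty_of_forall_notMem fun s hs => h0 ?_))
    exact (Nat.zero_le _).trans_lt (YoungDiagram.mem_iff_lt_colLen.1
      (mu.up_left_mem le_rfl s.2.zero_le ((YoungDiagram.mem_cells s).1 hs)))
  set j := mu.colLen 0 - 1 with hj
  have hrow : 0 < mu.rowLen j :=
    YoungDiagram.mem_iff_lt_rowLen.1 (YoungDiagram.mem_iff_lt_colLen.2 (by omega))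
  have hmem : (j, mu.rowLen j - 1) ∈ mu.cells :=
    (YoungDiagram.mem_cells _).2 (YoungDiagram.mem_iff_lt_rowLen.2 (by omega))
  let nu : YoungDiagram :=
    { cells := mu.cells.erase (j, mu.rowLen j - 1)
      isLowerSet := by
        rintro ⟨c, d⟩ ⟨a, b⟩ hle hcd
        simp only [Finset.coe_erase, Set.mem_sdiff, Finset.mem_coe, Set.mem_singleton_iff,
          YoungDiagram.mem_cells] at hcd ⊢
        refine ⟨mu.up_left_mem hle.1 hle.2 hcd.1, fun hab => hcd.2 ?_⟩
        obtain ⟨rfl, rfl⟩ := Prod.mk.inj hab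
        have h1 : j ≤ c := hle.1
        have h2 : mu.rowLen j - 1 ≤ d := hle.2
        have h3 := YoungDiagram.mem_iff_lt_colLen.1 (mu.up_left_mem le_rfl d.zero_le hcd.1)
        obtain rfl : c = j := by omega
        have h4 := YoungDiagram.mem_iff_lt_rowLen.1 hcd.1
        exact Prod.ext rfl (by simp only; omega) }
  have hnu : nu.rowLen j = mu.rowLen j - 1 := by
    refine eq_of_forall_lt_iff fun a => ?_
    rw [← YoungDiagram.mem_iff_lt_rowLen, ← YoungDiagram.mem_cells, Finset.mem_erase,
      YoungDiagram.mem_cells, YoungDiagram.mem_iff_lt_rowLen, ne_eq, Prod.mk.injEq]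
    omega
  refine ⟨nu, j, ?_⟩
  rw [IsAddBox, hnu]
  exact (Finset.insert_erase hmem).symm

lemma youngDiagram_induction {P : YoungDiagram → Prop} (h0 : P ⊥)
    (hs : ∀ mu mu' j, IsAddBox mu mu' j → P mu → P mu') (mu : YoungDiagram) : P mu := by
  induction hN : mu.cells.card generalizing mu with
  | zero =>
    obtain rfl : mu = ⊥ := YoungDiagram.ext (Finset.card_eq_zero.1 hN)
    exact h0
  | succ N ih =>
    obtain ⟨nu, j, h⟩ := exists_isAddBox (mu := mu) (by rintro rfl; simp at hN)
    refine hs nu mu j h (ih nu ?_)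
    rw [h, Finset.card_insert_of_notMem h.notMem] at hN
    omega

/-- The arm-leg formula for the character: both sides satisfy the same recursion in `μ`. -/
theorem nekrasovSum_eq_contractionSum (f : ℤ → ℤ → M) (lam mu : YoungDiagram) :
    nekrasovSum f lam mu = contractionSum f lam mu := by
  induction mu using youngDiagram_induction with
  | h0 =>
    have hbot : ∀ k, (⊥ : YoungDiagram).colLen k = 0 := fun k => by
      by_contra h
      exact YoungDiagram.notMem_bot _ (YoungDiagram.mem_iff_lt_colLen.2 (Nat.pos_of_ne_zero h))
    simp only [nekrasovSum, contractionSum, YoungDiagram.cells_bot, Finset.sum_empty, add_zero,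
      zero_add, sub_zero, sum_cells_eq_sum_rows]
    refine Finset.sum_congr rfl fun i _ => ?_
    rw [← Finset.sum_range_reflect]
    refine Finset.sum_congr rfl fun k hk => ?_
    rw [Finset.mem_range] at hk
    simp only [arm, leg, hbot]
    congr 1 <;> push_cast <;> omega
  | hs mu mu' j h ih => rw [nekrasovSum_addBox f lam h, contractionSum_addBox f lam h, ih]

end Character

/-! ### Power series determined by their power sums -/

section PowerSums

variable {K : Type*} [Field K]

/-- The power series `A` is `exp (-∑_{r ≥ 1} p_r X^r / r)`; for a product of factors `1 - y X`, the
`p_r` are the power sums of the `y`. -/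
def HasPowerSums (A : K⟦X⟧) (p : ℕ → K) : Prop :=
  PowerSeries.coeff 0 A = 1 ∧ euler A = (PowerSeries.mk fun r => if r = 0 then 0 else -p r) * A

lemma HasPowerSums.mul {A B : K⟦X⟧} {p q : ℕ → K} (hA : HasPowerSums A p)
    (hB : HasPowerSums B q) : HasPowerSums (A * B) (p + q) := by
  refine ⟨by simp [PowerSeries.coeff_mul, hA.1, hB.1], ?_⟩
  have h : (PowerSeries.mk fun r => if r = 0 then 0 else -(p + q) r) =
      (PowerSeries.mk fun r => if r = 0 then 0 else -p r) +
        PowerSeries.mk fun r => if r = 0 then 0 else -q r := by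
    ext r
    by_cases hr : r = 0 <;> simp [hr, add_comm]
  rw [euler_mul, hA.2, hB.2, h]
  ring

lemma hasPowerSums_one : HasPowerSums (1 : K⟦X⟧) 0 :=
  ⟨by simp, by
    rw [euler_one]
    ext r
    simp⟩

lemma hasPowerSums_linear (y : K) :
    HasPowerSums ((1 - Polynomial.C y * Polynomial.X : K[X]) : K⟦X⟧) (fun r => y ^ r) := by
  have h : ((1 - Polynomial.C y * Polynomial.X : K[X]) : K⟦X⟧) =
      1 - PowerSeries.C y * PowerSeries.X := by simp
  rw [h]
  refine ⟨by simp, ?_⟩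
  ext r
  rw [mul_sub, mul_one, ← mul_assoc, coeff_euler, map_sub, map_sub]
  rcases r with _ | _ | r
  · simp
  · simp [PowerSeries.coeff_succ_mul_X, PowerSeries.coeff_one]
  · simp [PowerSeries.coeff_succ_mul_X, PowerSeries.coeff_one, pow_succ]

lemma hasPowerSums_prod {ι : Type*} (s : Finset ι) {A : ι → K[X]} {p : ι → ℕ → K}
    (h : ∀ i ∈ s, HasPowerSums (A i : K⟦X⟧) (p i)) :
    HasPowerSums ((∏ i ∈ s, A i : K[X]) : K⟦X⟧) (∑ i ∈ s, p i) := by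
  classical
  induction s using Finset.induction_on with
  | empty => simpa using hasPowerSums_one
  | insert a s ha ih =>
    rw [Finset.prod_insert ha, Finset.sum_insert ha, Polynomial.coe_mul]
    exact (h a (Finset.mem_insert_self a s)).mul
      (ih fun i hi => h i (Finset.mem_insert_of_mem hi))

lemma HasPowerSums.congr {A : K⟦X⟧} {p q : ℕ → K} (h : HasPowerSums A p)
    (hpq : ∀ r, 0 < r → p r = q r) : HasPowerSums A q := by
  refine ⟨h.1, h.2.trans ?_⟩
  congr 1
  ext r
  rcases Nat.eq_zero_or_pos r with rfl | hr
  · simp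
  · simp [hr.ne', hpq r hr]

lemma HasPowerSums.unique [CharZero K] {A B : K⟦X⟧} {p : ℕ → K} (hA : HasPowerSums A p)
    (hB : HasPowerSums B p) : A = B :=
  eq_of_euler_eq_mul (K := K) (by simp) hA.2 hB.2 (hA.1.trans hB.1.symm)

end PowerSums

/-! ### The operator product factor is the Nekrasov factor -/

section Comparison

variable {K : Type*} [Field K] {n : ℕ}

/-- The `r`-th power of the weight `p₁^a p₃^b`, restricted to weights with `b ≡ a` modulo `n`. -/
noncomputable def coloredPower (n : ℕ) (p1 p3 : K) (r : ℕ) (a b : ℤ) : K :=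
  open Classical in if (n : ℤ) ∣ b - a then (p1 ^ a * p3 ^ b) ^ r else 0

/-- The power sums of a product of factors over boxes or rows of a fixed color. -/
lemma hasPowerSums_prod_filter {ι : Type*} (p1 p3 : K) (s : Finset ι) (P : ι → Prop)
    [DecidablePred P] (a b : ι → ℤ) (hP : ∀ i ∈ s, P i ↔ (n : ℤ) ∣ b i - a i) :
    HasPowerSums ((∏ i ∈ s with P i,
        (1 - Polynomial.C (p1 ^ a i * p3 ^ b i) * Polynomial.X) : K[X]) : K⟦X⟧)
      (fun r => ∑ i ∈ s, coloredPower n p1 p3 r (a i) (b i)) := by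
  convert hasPowerSums_prod _ fun i _ => hasPowerSums_linear (p1 ^ a i * p3 ^ b i) using 1
  funext r
  rw [Finset.sum_apply, Finset.sum_filter]
  refine Finset.sum_congr rfl fun i hi => ?_
  simp only [coloredPower, hP i hi]

lemma hasPowerSums_nekrasov (p1 p3 : K) (lam mu : YoungDiagram) :
    HasPowerSums (nekrasov n p1 p3 lam mu : K⟦X⟧)
      (fun r => nekrasovSum (coloredPower n p1 p3 r) lam mu) := by
  rw [nekrasov, Polynomial.coe_mul]
  refine (hasPowerSums_prod_filter p1 p3 lam.cells _ (arm lam) (fun s => -leg mu s - 1) ?_).mul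
    (hasPowerSums_prod_filter p1 p3 mu.cells _ (fun t => -arm mu t - 1) (leg lam) ?_)
  · intro s _
    rw [← dvd_neg, relHook]
    ring_nf
  · intro t _
    rw [relHook]
    ring_nf

lemma hasPowerSums_recursionNum (p1 p3 : K) (lam mu : YoungDiagram) (j : ℕ) :
    HasPowerSums (recursionNum n p1 p3 lam mu j : K⟦X⟧) (fun r =>
      ∑ i ∈ Finset.range (lam.colLen 0 + 1), coloredPower n p1 p3 r
        ((lam.rowLen i : ℤ) - mu.rowLen j - 1) ((i : ℤ) - j - 1)) := by
  refine hasPowerSums_prod_filter p1 p3 _ _ (fun i : ℕ => (lam.rowLen i : ℤ) - mu.rowLen j - 1)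
    (fun i : ℕ => (i : ℤ) - j - 1) fun i _ => ?_
  rw [Int.modEq_comm, Int.modEq_iff_dvd]
  ring_nf

lemma hasPowerSums_recursionDen (p1 p3 : K) (lam mu : YoungDiagram) (j : ℕ) :
    HasPowerSums (recursionDen n p1 p3 lam mu j : K⟦X⟧) (fun r =>
      ∑ i ∈ Finset.range (lam.colLen 0), coloredPower n p1 p3 r
        ((lam.rowLen i : ℤ) - mu.rowLen j - 1) ((i : ℤ) - j)) := by
  refine hasPowerSums_prod_filter p1 p3 _ _ (fun i : ℕ => (lam.rowLen i : ℤ) - mu.rowLen j - 1)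
    (fun i : ℕ => (i : ℤ) - j) fun i _ => ?_
  rw [Int.modEq_comm, Int.modEq_iff_dvd]
  ring_nf

/-- The recursion of the Nekrasov factor in its second diagram. -/
theorem nekrasov_mul_recursionDen [CharZero K] (p1 p3 : K) (lam : YoungDiagram)
    {mu mu' : YoungDiagram} {j : ℕ} (h : IsAddBox mu mu' j) :
    nekrasov n p1 p3 lam mu' * recursionDen n p1 p3 lam mu j =
      recursionNum n p1 p3 lam mu j * nekrasov n p1 p3 lam mu := by
  apply Polynomial.coe_injective
  rw [Polynomial.coe_mul, Polynomial.coe_mul]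
  refine ((hasPowerSums_nekrasov p1 p3 lam mu').mul
    (hasPowerSums_recursionDen p1 p3 lam mu j)).unique ?_
  convert (hasPowerSums_recursionNum p1 p3 lam mu j).mul
    (hasPowerSums_nekrasov p1 p3 lam mu) using 1
  funext r
  simp only [Pi.add_apply, nekrasovSum_addBox _ lam h, recursionSum]
  ring

lemma ne_zero_of_hasPowerSums {A : K[X]} {p : ℕ → K} (h : HasPowerSums (A : K⟦X⟧) p) : A ≠ 0 := by
  rintro rfl
  simpa using h.1

lemma color_sub_eq_zero_iff [NeZero n] (s t : ℕ × ℕ) (e : ℤ) :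
    color n s = color n t + e ↔ (n : ℤ) ∣ ((s.1 : ℤ) - t.1) - ((s.2 : ℤ) - t.2) - e := by
  rw [← ZMod.intCast_zmod_eq_zero_iff_dvd, ← sub_eq_zero, color, color]
  push_cast
  ring_nf

/-- In degree `r`, the commutator of the oscillators reproduces the character of
`contractionSum`, up to the vacuum contribution. -/
lemma neg_opeScalar [NeZero n] {𝔮 𝔡 : K} (hn : 2 < n) (h𝔮 : 𝔮 ≠ 0) (h𝔡 : 𝔡 ≠ 0) {r : ℕ}
    (hr' : qInt 𝔮 r ≠ 0) (lam mu : YoungDiagram) :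
    -(𝔮 ^ r * opeScalar n 𝔮 𝔡 lam mu r) =
      contractionSum (coloredPower n (q1 𝔮 𝔡) (q3 𝔮 𝔡) r) lam mu -
        𝔮 ^ r * opeScalar n 𝔮 𝔡 ⊥ ⊥ r := by
  have hq1 : q1 𝔮 𝔡 ≠ 0 := mul_ne_zero h𝔡 (inv_ne_zero h𝔮)
  have hq3 : q3 𝔮 𝔡 ≠ 0 := mul_ne_zero (inv_ne_zero h𝔡) (inv_ne_zero h𝔮)
  have e1 : (q1 𝔮 𝔡 ^ r)⁻¹ = 𝔮 ^ r * (𝔡 ^ r)⁻¹ := by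
    rw [q1, mul_pow, inv_pow, mul_inv, inv_inv, mul_comm]
  have e3 : (q3 𝔮 𝔡 ^ r)⁻¹ = 𝔮 ^ r * 𝔡 ^ r := by
    rw [q3, mul_pow, inv_pow, inv_pow, mul_inv, inv_inv, inv_inv, mul_comm]
  have hd : 𝔡 ^ r ≠ 0 := pow_ne_zero _ h𝔡
  have hq : 𝔮 ^ r ≠ 0 := pow_ne_zero _ h𝔮
  -- the weights of the four terms, and of the boundary terms
  have hw : ∀ s t : ℕ × ℕ, ∀ a b : ℤ,
      (q1 𝔮 𝔡 ^ ((s.2 : ℤ) - t.2 - a) * q3 𝔮 𝔡 ^ ((s.1 : ℤ) - t.1 - b)) ^ r =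
        (boxWeight 𝔮 𝔡 s / boxWeight 𝔮 𝔡 t) ^ r * ((q1 𝔮 𝔡 ^ r)⁻¹ ^ a * (q3 𝔮 𝔡 ^ r)⁻¹ ^ b) := by
    intro s t a b
    have e : ∀ (x : K) (c : ℤ), (x ^ r)⁻¹ ^ c = ((x ^ c) ^ r)⁻¹ := fun x c => by
      rw [inv_zpow, ← zpow_natCast, ← zpow_natCast, zpow_comm]
    rw [e, e, ← inv_pow, ← inv_pow, ← mul_pow, ← mul_pow, zpow_sub₀ hq1, zpow_sub₀ hq1,
      zpow_sub₀ hq3, zpow_sub₀ hq3, boxWeight, boxWeight]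
    simp only [zpow_natCast]
    congr 1
    field_simp
  have hcolor : ∀ (s t : ℕ × ℕ) (a b : ℤ),
      coloredPower n (q1 𝔮 𝔡) (q3 𝔮 𝔡) r ((s.2 : ℤ) - t.2 - a) ((s.1 : ℤ) - t.1 - b) =
        if color n s = color n t + ((b - a : ℤ) : ZMod n) then
          (boxWeight 𝔮 𝔡 s / boxWeight 𝔮 𝔡 t) ^ r * ((q1 𝔮 𝔡 ^ r)⁻¹ ^ a * (q3 𝔮 𝔡 ^ r)⁻¹ ^ b)
        else 0 := by
    intro s t a b
    rw [coloredPower, hw]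
    have : (s.1 : ℤ) - t.1 - b - ((s.2 : ℤ) - t.2 - a) =
      ((s.1 : ℤ) - t.1) - ((s.2 : ℤ) - t.2) - (b - a) := by ring
    simp only [color_sub_eq_zero_iff, this]
  have hcell : ∀ s t : ℕ × ℕ, 𝔮 ^ r * ((boxWeight 𝔮 𝔡 s / boxWeight 𝔮 𝔡 t) ^ r *
      defCartan n 𝔮 𝔡 r (color n t) (color n s)) =
      coloredPower n (q1 𝔮 𝔡) (q3 𝔮 𝔡) r ((s.2 : ℤ) - t.2) ((s.1 : ℤ) - t.1) -
        coloredPower n (q1 𝔮 𝔡) (q3 𝔮 𝔡) r ((s.2 : ℤ) - t.2 - 1) ((s.1 : ℤ) - t.1) -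
        coloredPower n (q1 𝔮 𝔡) (q3 𝔮 𝔡) r ((s.2 : ℤ) - t.2) ((s.1 : ℤ) - t.1 - 1) +
        coloredPower n (q1 𝔮 𝔡) (q3 𝔮 𝔡) r ((s.2 : ℤ) - t.2 - 1) ((s.1 : ℤ) - t.1 - 1) := by
    intro s t
    have h00 := hcolor s t 0 0
    have h10 := hcolor s t 1 0
    have h01 := hcolor s t 0 1
    have h11 := hcolor s t 1 1
    rw [sub_zero, sub_zero] at h00
    rw [sub_zero] at h10 h01
    rw [h00, h10, h01, h11, defCartan_apply hn hr', e1, e3]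
    simp only [sub_self, Int.cast_zero, add_zero, zero_sub, Int.cast_neg, Int.cast_one, sub_zero,
      ← sub_eq_add_neg, zpow_zero, zpow_one, zpow_neg, zpow_natCast, mul_one, one_mul,
      eq_comm (a := color n s)]
    split_ifs <;> field_simp <;> ring
  have hmu : ∀ t : ℕ × ℕ, 𝔮 ^ r * (if color n t = 0 then (𝔮 / boxWeight 𝔮 𝔡 t) ^ r else 0) =
      coloredPower n (q1 𝔮 𝔡) (q3 𝔮 𝔡) r (-1 - t.2) (-1 - t.1) := by
    intro t
    have h11 := hcolor (0, 0) t 1 1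
    simp only [Nat.cast_zero, sub_self, Int.cast_zero, add_zero, zpow_one, e1, e3,
      show color n (0, 0) = 0 by simp [color], show boxWeight 𝔮 𝔡 (0, 0) = 1 by simp [boxWeight],
      eq_comm (a := (0 : ZMod n))] at h11
    rw [show (-1 - (t.2 : ℤ)) = 0 - t.2 - 1 by ring, show (-1 - (t.1 : ℤ)) = 0 - t.1 - 1 by ring,
      h11]
    split_ifs
    · rw [div_pow, div_pow, one_pow]; field_simp
    · simp
  have hlam : ∀ s : ℕ × ℕ, 𝔮 ^ r * (if color n s = 0 then (boxWeight 𝔮 𝔡 s / 𝔮) ^ r else 0) =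
      coloredPower n (q1 𝔮 𝔡) (q3 𝔮 𝔡) r s.2 s.1 := by
    intro s
    have h00 := hcolor s (0, 0) 0 0
    simp only [Nat.cast_zero, sub_self, sub_zero, Int.cast_zero, add_zero, zpow_zero, mul_one,
      show color n (0, 0) = 0 by simp [color], show boxWeight 𝔮 𝔡 (0, 0) = 1 by simp [boxWeight],
      div_one] at h00
    rw [h00]
    split_ifs
    · rw [div_pow]; field_simp
    · simp
  have hempty : opeScalar n 𝔮 𝔡 ⊥ ⊥ r = invCartan n 𝔮 𝔡 r 0 0 := by simp [opeScalar]
  rw [hempty, opeScalar, contractionSum]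
  simp only [← hcell, ← hmu, ← hlam, ← Finset.mul_sum]
  ring

variable [NeZero n] {𝔰 𝔮 𝔡 : K}

lemma isOPEFactor_opeFactor {lam mu : YoungDiagram} (h : ∃ G, IsOPEFactor n 𝔰 𝔮 𝔡 lam mu G) :
    IsOPEFactor n 𝔰 𝔮 𝔡 lam mu (opeFactor n 𝔰 𝔮 𝔡 lam mu) :=
  Classical.epsilon_spec h

lemma hasPowerSums_opeFactor [CharZero K] (hn : 2 < n) (h𝔰 : 𝔰 ^ 2 = 𝔮) (h𝔮 : 𝔮 ≠ 0)
    (h𝔡 : 𝔡 ≠ 0) (h1 : ∀ r : ℕ, 0 < r → q1 𝔮 𝔡 ^ r ≠ 1) (h2 : ∀ r : ℕ, 0 < r → q2 𝔮 ^ r ≠ 1)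
    (h3 : ∀ r : ℕ, 0 < r → q3 𝔮 𝔡 ^ r ≠ 1) (lam mu : YoungDiagram) :
    HasPowerSums (opeFactor n 𝔰 𝔮 𝔡 lam mu) (fun r => -(𝔮 ^ r * opeScalar n 𝔮 𝔡 lam mu r)) := by
  obtain ⟨G, hG, hG0, hG'⟩ := exists_isOPEFactor hn h𝔰 h𝔮 h𝔡 h1 h2 h3 lam mu
  rw [(isOPEFactor_opeFactor ⟨G, hG⟩).unique h𝔮 hG]
  exact ⟨hG0, by simpa only [neg_neg] using hG'⟩

/-- The vacuum contribution to the power sums cancels in the quotient by the vacuum factor, and the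
rest are the power sums of the Nekrasov factor. -/
theorem renormalizedOPEFactor_eq_nekrasov [CharZero K] (hn : 2 < n) (h𝔰 : 𝔰 ^ 2 = 𝔮)
    (h𝔮 : 𝔮 ≠ 0) (h𝔡 : 𝔡 ≠ 0) (h1 : ∀ r : ℕ, 0 < r → q1 𝔮 𝔡 ^ r ≠ 1)
    (h2 : ∀ r : ℕ, 0 < r → q2 𝔮 ^ r ≠ 1) (h3 : ∀ r : ℕ, 0 < r → q3 𝔮 𝔡 ^ r ≠ 1)
    (lam mu : YoungDiagram) :
    renormalizedOPEFactor n 𝔰 𝔮 𝔡 lam mu = (nekrasov n (q1 𝔮 𝔡) (q3 𝔮 𝔡) lam mu : K⟦X⟧) := by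
  have hvac := hasPowerSums_opeFactor hn h𝔰 h𝔮 h𝔡 h1 h2 h3 ⊥ ⊥
  have h : opeFactor n 𝔰 𝔮 𝔡 lam mu =
      (nekrasov n (q1 𝔮 𝔡) (q3 𝔮 𝔡) lam mu : K⟦X⟧) * opeFactor n 𝔰 𝔮 𝔡 ⊥ ⊥ := by
    refine ((hasPowerSums_opeFactor hn h𝔰 h𝔮 h𝔡 h1 h2 h3 lam mu).congr fun r hr => ?_).unique
      ((hasPowerSums_nekrasov (q1 𝔮 𝔡) (q3 𝔮 𝔡) lam mu).mul hvac)
    rw [neg_opeScalar hn h𝔮 h𝔡 (qInt_ne_zero h𝔮 h2 hr), Pi.add_apply,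
      nekrasovSum_eq_contractionSum, sub_eq_add_neg]
  rw [renormalizedOPEFactor, h, mul_assoc, PowerSeries.mul_inv_cancel, mul_one]
  rw [← PowerSeries.coeff_zero_eq_constantCoeff_apply, hvac.1]
  exact one_ne_zero

end Comparison
end ToroidalOPE

theorem mainTheorem3 {K : Type*} [Field K] [CharZero K] (n : ℕ) [NeZero n] (hn : 2 < n)
    (𝔰 𝔮 𝔡 : K) (h𝔰 : 𝔰 ^ 2 = 𝔮) (h𝔮 : 𝔮 ≠ 0) (h𝔡 : 𝔡 ≠ 0)
    (h1 : ∀ r : ℕ, 0 < r → ToroidalOPE.q1 𝔮 𝔡 ^ r ≠ 1)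
    (h2 : ∀ r : ℕ, 0 < r → ToroidalOPE.q2 𝔮 ^ r ≠ 1)
    (h3 : ∀ r : ℕ, 0 < r → ToroidalOPE.q3 𝔮 𝔡 ^ r ≠ 1) :
    -- the OPE factors exist and are unique, and the vacuum one is invertible
    (∀ lam mu : YoungDiagram, ∃! G : PowerSeries K, ToroidalOPE.IsOPEFactor n 𝔰 𝔮 𝔡 lam mu G) ∧
    IsUnit (ToroidalOPE.opeFactor n 𝔰 𝔮 𝔡 ⊥ ⊥) ∧
    -- the renormalized OPE factor is the Nekrasov factor
    (∀ lam mu : YoungDiagram,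
      ToroidalOPE.renormalizedOPEFactor n 𝔰 𝔮 𝔡 lam mu =
        (ToroidalOPE.nekrasov n (ToroidalOPE.q1 𝔮 𝔡) (ToroidalOPE.q3 𝔮 𝔡) lam mu :
          PowerSeries K)) ∧
    -- both factors satisfy the same recursion in the second diagram
    (∀ (lam mu mu' : YoungDiagram) (j : ℕ), ToroidalOPE.IsAddBox mu mu' j →
      algebraMap (Polynomial K) (RatFunc K)
          (ToroidalOPE.nekrasov n (ToroidalOPE.q1 𝔮 𝔡) (ToroidalOPE.q3 𝔮 𝔡) lam mu') /
        algebraMap (Polynomial K) (RatFunc K)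
          (ToroidalOPE.nekrasov n (ToroidalOPE.q1 𝔮 𝔡) (ToroidalOPE.q3 𝔮 𝔡) lam mu) =
      algebraMap (Polynomial K) (RatFunc K)
          (ToroidalOPE.recursionNum n (ToroidalOPE.q1 𝔮 𝔡) (ToroidalOPE.q3 𝔮 𝔡) lam mu j) /
        algebraMap (Polynomial K) (RatFunc K)
          (ToroidalOPE.recursionDen n (ToroidalOPE.q1 𝔮 𝔡) (ToroidalOPE.q3 𝔮 𝔡) lam mu j)) ∧
    (∀ (lam mu mu' : YoungDiagram) (j : ℕ), ToroidalOPE.IsAddBox mu mu' j →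
      ToroidalOPE.renormalizedOPEFactor n 𝔰 𝔮 𝔡 lam mu' *
          (ToroidalOPE.recursionDen n (ToroidalOPE.q1 𝔮 𝔡) (ToroidalOPE.q3 𝔮 𝔡) lam mu j :
            PowerSeries K) =
        (ToroidalOPE.recursionNum n (ToroidalOPE.q1 𝔮 𝔡) (ToroidalOPE.q3 𝔮 𝔡) lam mu j :
            PowerSeries K) *
          ToroidalOPE.renormalizedOPEFactor n 𝔰 𝔮 𝔡 lam mu) := by
  refine ⟨fun lam mu => ?_, ?_, ?_, ?_, ?_⟩
  · obtain ⟨G, hG, -⟩ := ToroidalOPE.exists_isOPEFactor hn h𝔰 h𝔮 h𝔡 h1 h2 h3 lam mu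
    exact ⟨G, hG, fun G' hG' => hG'.unique h𝔮 hG⟩
  · rw [PowerSeries.isUnit_iff_constantCoeff, ← PowerSeries.coeff_zero_eq_constantCoeff_apply,
      (ToroidalOPE.hasPowerSums_opeFactor hn h𝔰 h𝔮 h𝔡 h1 h2 h3 ⊥ ⊥).1]
    exact isUnit_one
  · exact ToroidalOPE.renormalizedOPEFactor_eq_nekrasov hn h𝔰 h𝔮 h𝔡 h1 h2 h3
  · intro lam mu mu' j h
    have hinj := IsFractionRing.injective (Polynomial K) (RatFunc K)
    rw [div_eq_div_iff
      ((map_ne_zero_iff _ hinj).2 (ToroidalOPE.ne_zero_of_hasPowerSums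
        (ToroidalOPE.hasPowerSums_nekrasov (n := n) _ _ lam mu)))
      ((map_ne_zero_iff _ hinj).2 (ToroidalOPE.ne_zero_of_hasPowerSums
        (ToroidalOPE.hasPowerSums_recursionDen (n := n) _ _ lam mu j))),
      ← map_mul, ← map_mul, ToroidalOPE.nekrasov_mul_recursionDen _ _ lam h]
  · intro lam mu mu' j h
    rw [ToroidalOPE.renormalizedOPEFactor_eq_nekrasov hn h𝔰 h𝔮 h𝔡 h1 h2 h3,
      ToroidalOPE.renormalizedOPEFactor_eq_nekrasov hn h𝔰 h𝔮 h𝔡 h1 h2 h3, ← Polynomial.coe_mul,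
      ← Polynomial.coe_mul, ToroidalOPE.nekrasov_mul_recursionDen _ _ lam h]
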